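/- Let $p\neq 2$ be a prime and let $Q(k)=k_0^2-k_1^2-k_2^2-k_3^2$ on $\mathbb{Q}_p^4$, with associated bilinear form $[x,y]=x_0y_0-x_1y_1-x_2y_2-x_3y_3$ and orthogonal group $O(Q)=\{\Lambda\in GL_4(\mathbb{Q}_p):[\Lambda x,\Lambda y]=[x,y]\text{ for all }x,y\}$. For $t\in\mathbb{Q}_p^{\times}$ let $V_t=\{k\in\mathbb{Q}_p^4: Q(k)=t\}$. An $O(Q)$-invariant measure on $V_t$ means a nonzero Radon measure $\mu$ on $\mathbb{Q}_p^4$ with $\mu(\mathbb{Q}_p^4\setminus V_t)=0$ and $\Lambda_*\mu=\mu$ for all $\Lambda\in O(Q)$. A Gel'fand–Leray form for $V_t$ is a differential $3$-form $\omega$, $p$-adic analytic in a neighbourhood of $V_t$, with $dk_0\wedge dk_1\wedge dk_2\wedge dk_3=dQ\wedge\omega$ at every point of $V_t$. The Gel'fand–Leray measure $\lambda_t$, also denoted $\delta(Q(k)-t)$, is the Borel measure on $\mathbb{Q}_p^4$ with $\lambda_t(\mathbb{Q}_p^4\setminus V_t)=0$ induced by such an $\omega$: whenever $W\subset\mathbb{Q}_p^3$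 is open and compact, $h:W\to\mathbb{Q}_p$ is $p$-adic analytic, $l\in\{0,1,2,3\}$, and the map $\psi:W\to\mathbb{Q}_p^4$ inserting $h(y)$ into $y$ as the coordinate $k_l$ takes values in $V_t$ with $\frac{\partial Q}{\partial k_l}\neq 0$ along its image, one has for every open compact $B\subset W$ $$\lambda_t(\psi(B))=\int_B |g(y)|_p\,d^3y,\qquad \text{where } \psi^*\omega=g\,dy_0\wedge dy_1\wedge dy_2$$ and $d^3y$ is the normalized Haar measure of $\mathbb{Q}_p^3$. Then, for every $t\in\mathbb{Q}_p^{\times}$, the measure $\lambda_t$ exists and is unique (in particular it does not depend on the choice of $\omega$); $\lambda_t$ is an $O(Q)$-invariant measure on $V_t$, and the distribution $\varphi\mapsto\int\varphi\,d\lambda_t$ is well defined and satisfies $\int\varphi(\Lambda k)\,d\lambda_t(k)=\int\varphi(k)\,d\lambda_t(k)$ for all $\Lambda\in O(Q)$ and all locally constant, compactly supported $\varphi:\mathbb{Q}_p^4\to\mathbb{C}$; and every $O(Q)$-invariant measure $\mu_t$ on $V_t$ satisfies $\mu_t=A\lambda_t$ for some constant $A>0$. -/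

import Mathlib

open MeasureTheory Set
open scoped NNReal ENNReal

namespace PAdicMinkowski

noncomputable section

/-- `ℚ_[p]` carries its Borel σ-algebra; finite products then carry the Borel σ-algebra too. -/
instance instMeasurableSpacePadic (p : ℕ) [Fact p.Prime] : MeasurableSpace ℚ_[p] :=
  borel ℚ_[p]

instance instBorelSpacePadic (p : ℕ) [Fact p.Prime] : BorelSpace ℚ_[p] := ⟨rfl⟩

/-- The compact set `{x : |x|_p ≤ 1}` with nonempty interior (the ring of `p`-adic integers). -/
def unitBall (p : ℕ) [Fact p.Prime] : TopologicalSpace.PositiveCompacts ℚ_[p] where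
  carrier := Metric.closedBall 0 1
  isCompact' := isCompact_closedBall 0 1
  interior_nonempty' :=
    ⟨0, Metric.ball_subset_interior_closedBall (Metric.mem_ball_self one_pos)⟩

/-- The Haar measure on `ℚ_[p]` giving the `p`-adic integers mass `1`. -/
def haar (p : ℕ) [Fact p.Prime] : Measure ℚ_[p] :=
  Measure.addHaarMeasure (unitBall p)

/-- The normalized Haar measure on `ℚ_[p]^n`. -/
def haarPi (p : ℕ) [Fact p.Prime] (n : ℕ) : Measure (Fin n → ℚ_[p]) :=
  Measure.pi (fun _ => haar p)

/-- The bilinear form `[x, y] = x₀y₀ - x₁y₁ - x₂y₂ - x₃y₃`. -/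
def bilin {p : ℕ} [Fact p.Prime] (x y : Fin 4 → ℚ_[p]) : ℚ_[p] :=
  x 0 * y 0 - x 1 * y 1 - x 2 * y 2 - x 3 * y 3

/-- The quadratic form `Q(x) = [x, x]`. -/
def Q {p : ℕ} [Fact p.Prime] (x : Fin 4 → ℚ_[p]) : ℚ_[p] := bilin x x

/-- The level set `V_t = {Q = t}`. -/
def V {p : ℕ} [Fact p.Prime] (t : ℚ_[p]) : Set (Fin 4 → ℚ_[p]) := {k | Q k = t}

/-- The linear action of `GL₄` on column vectors. -/
def act {p : ℕ} [Fact p.Prime] (Λ : GL (Fin 4) ℚ_[p]) (x : Fin 4 → ℚ_[p]) : Fin 4 → ℚ_[p] :=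
  (Λ : Matrix (Fin 4) (Fin 4) ℚ_[p]).mulVec x

/-- The orthogonal group `O(Q)`. -/
def orthogonalGroup (p : ℕ) [Fact p.Prime] : Subgroup (GL (Fin 4) ℚ_[p]) where
  carrier := {Λ | ∀ x y, bilin (act Λ x) (act Λ y) = bilin x y}
  one_mem' := by
    intro x y
    simp [act]
  mul_mem' := by
    intro a b ha hb x y
    have h : ∀ z, act (a * b) z = act a (act b z) := by
      intro z
      simp [act, Matrix.mulVec_mulVec]
    rw [h, h, ha, hb]
  inv_mem' := by
    intro a ha x y
    have h : ∀ z, act a (act a⁻¹ z) = z := by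
      intro z
      rw [act, act, Matrix.mulVec_mulVec, ← Units.val_mul, mul_inv_cancel]
      simp
    rw [← ha, h, h]

/-- `μ`, seen as a measure on `ℚ_[p]^4` carried by the closed set `V_t`, is an `O(Q)`-invariant
measure on `V_t`: a nonzero Radon measure (Borel, finite on compact sets) with `Λ_* μ = μ` for all
`Λ ∈ O(Q)`. -/
structure IsInvariantMeasure {p : ℕ} [Fact p.Prime] (t : ℚ_[p])
    (μ : Measure (Fin 4 → ℚ_[p])) : Prop where
  supported : μ (V t)ᶜ = 0
  finite_on_compacts : ∀ K : Set (Fin 4 → ℚ_[p]), IsCompact K → μ K < ∞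
  ne_zero : μ ≠ 0
  invariant : ∀ Λ ∈ orthogonalGroup p, μ.map (act Λ) = μ

/-- The value on `v₀, v₁, v₂, v₃` of the wedge product `α ∧ ω` of a covector and an alternating
`3`-form. -/
def wedge {p : ℕ} [Fact p.Prime] (α : (Fin 4 → ℚ_[p]) →L[ℚ_[p]] ℚ_[p])
    (ω : (Fin 4 → ℚ_[p]) [⋀^Fin 3]→L[ℚ_[p]] ℚ_[p]) (v : Fin 4 → (Fin 4 → ℚ_[p])) : ℚ_[p] :=
  ∑ i : Fin 4, (-1) ^ (i : ℕ) * α (v i) * ω (fun j : Fin 3 => v (i.succAbove j))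

/-- `ω` is a Gel'fand-Leray form for `V_t`: a `3`-form, `p`-adic analytic near `V_t`, such that
`dk₀ ∧ dk₁ ∧ dk₂ ∧ dk₃ = dQ ∧ ω` at every point of `V_t`. -/
structure IsGelfandLerayForm {p : ℕ} [Fact p.Prime] (t : ℚ_[p])
    (ω : (Fin 4 → ℚ_[p]) → (Fin 4 → ℚ_[p]) [⋀^Fin 3]→L[ℚ_[p]] ℚ_[p]) : Prop where
  analytic : AnalyticOnNhd ℚ_[p] ω (V t)
  wedge_eq : ∀ k ∈ V t, ∀ v : Fin 4 → (Fin 4 → ℚ_[p]),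
    (Matrix.of v).det = wedge (fderiv ℚ_[p] Q k) (ω k) v

/-- A chart of `V_t`, given as the graph `k_l = h(y)` of a `p`-adic analytic function `h` of the
three other coordinates `y` on an open compact set `W`, with `∂Q/∂k_l ≠ 0` along the graph. -/
structure GraphChart {p : ℕ} [Fact p.Prime] (t : ℚ_[p]) where
  l : Fin 4
  W : Set (Fin 3 → ℚ_[p])
  h : (Fin 3 → ℚ_[p]) → ℚ_[p]
  isCompact_W : IsCompact W
  isOpen_W : IsOpen W
  analytic : AnalyticOnNhd ℚ_[p] h W
  mem_V : ∀ y ∈ W, (l.insertNth (h y) y : Fin 4 → ℚ_[p]) ∈ V t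
  partial_ne_zero : ∀ y ∈ W,
    fderiv ℚ_[p] Q (l.insertNth (h y) y : Fin 4 → ℚ_[p]) (Pi.single l 1) ≠ 0

/-- The parametrization `y ↦ (y with h(y) inserted as l-th coordinate)` of a graph chart. -/
def GraphChart.param {p : ℕ} [Fact p.Prime] {t : ℚ_[p]} (c : GraphChart t)
    (y : Fin 3 → ℚ_[p]) : Fin 4 → ℚ_[p] :=
  c.l.insertNth (c.h y) y

/-- `lam` is the measure `|ω|` induced on `V_t` by the restriction of the `3`-form `ω` to `V_t`:
it is carried by `V_t`, and in every graph chart it is the density `|g(y)|_p` times Haar measure,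
where `g(y) dy₀ ∧ dy₁ ∧ dy₂` is the pull-back of `ω` by the parametrization. -/
structure IsMeasureOfForm {p : ℕ} [Fact p.Prime] (t : ℚ_[p])
    (ω : (Fin 4 → ℚ_[p]) → (Fin 4 → ℚ_[p]) [⋀^Fin 3]→L[ℚ_[p]] ℚ_[p])
    (lam : Measure (Fin 4 → ℚ_[p])) : Prop where
  supported : lam (V t)ᶜ = 0
  chart : ∀ c : GraphChart t, ∀ B ⊆ c.W, IsCompact B → IsOpen B →
    lam (c.param '' B) =
      ∫⁻ y in B, ‖ω (c.param y) (fun i : Fin 3 => fderiv ℚ_[p] c.param y (Pi.single i 1))‖ₑ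
        ∂(haarPi p 3)

/-- `lam` is the Gel'fand-Leray measure `λ_t = δ(Q(k) - t)`: the measure on `V_t` induced by a
Gel'fand-Leray form. -/
def IsGelfandLerayMeasure {p : ℕ} [Fact p.Prime] (t : ℚ_[p])
    (lam : Measure (Fin 4 → ℚ_[p])) : Prop :=
  ∃ ω, IsGelfandLerayForm t ω ∧ IsMeasureOfForm t ω lam

/-- Bruhat-Schwartz (test) functions: locally constant with compact support. -/
def IsTestFunction {p : ℕ} [Fact p.Prime] (φ : (Fin 4 → ℚ_[p]) → ℂ) : Prop :=
  IsLocallyConstant φ ∧ HasCompactSupport φ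

end

end PAdicMinkowski

/-! Existence. For p ≠ 2, squaring is an isometric bijection of 1 + pℤ_p with analytic inverse.
Hence the open cone |Q(k)/t - 1| < 1 has polar coordinates k = s x, with x ∈ V_t, s ∈ 1 + pℤ_p and
s² = Q(k)/t, and Haar measure on it should be |t| ds times λ_t. `leray` turns this into a
definition: the normalized push-forward of Haar measure along rays. Elements of O(Q) commute with
scaling, preserve Q and have determinant of norm 1, so `leray` is visibly invariant
(`isInvariantMeasure_leray`).

Identification in charts. Contracting the volume form with the Euler field and dividing by 2t gives
a Gel'fand-Leray form, by Cramer's rule. Any such form has density 1/|k_l| in a graph chart, since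
dQ kills tangent vectors; so the choice of form is irrelevant. That `leray` has this density too is
`leray_image_param`: the cone over a chart piece has a fixed multiple of the mass of the thin shell
|s - 1| ≤ |q|, and that shell is exactly the tube |x - h(z)| ≤ |q t / h(z)| around the graph. Charts
cover V_t and small balls determine a measure, whence uniqueness of λ_t.

Uniqueness of invariant measures. Reflections make O(Q) transitive on V_t. Points of V_t close to a
base point are even reached by elements preserving the sup norm, so balls of equal radius centred
there have equal mass. Applying Fubini to the pairs of points at distance at most r, two such
measures are proportional on small balls; transitivity spreads this over V_t. -/

namespace PAdicMinkowski

/-! ### Haar measure on ℚ_p^n: balls and the modulus of linear maps -/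

section Haar

open Metric

variable {p : ℕ} [Fact p.Prime]

instance : (haar p).IsAddHaarMeasure := by unfold haar; infer_instance

instance (n : ℕ) : (haarPi p n).IsAddHaarMeasure := by unfold haarPi; infer_instance

theorem haar_closedBall_center (x : ℚ_[p]) (r : ℝ) :
    haar p (closedBall x r) = haar p (closedBall 0 r) := by
  have h : (fun y => x + y) ⁻¹' closedBall x r = closedBall 0 r := by
    ext y; simp
  rw [← h, measure_preimage_add]

/-- This is the decomposition of a ℤ_p into cosets of p a ℤ_p, with representatives i a for the
residues i mod p. -/
theorem closedBall_eq_iUnion_closedBall (a : ℚ_[p]) (ha : a ≠ 0) :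
    closedBall (0 : ℚ_[p]) ‖a‖ = ⋃ i : Fin p, closedBall ((i : ℕ) * a) ‖(p : ℚ_[p]) * a‖ := by
  have ha' : 0 < ‖a‖ := norm_pos_iff.2 ha
  ext x
  simp only [mem_closedBall, mem_iUnion, dist_eq_norm, sub_zero]
  constructor
  · intro hx
    have h1 : ‖x / a‖ ≤ 1 := by
      rw [norm_div]; exact div_le_one_of_le₀ hx ha'.le
    obtain ⟨z, hz⟩ : ∃ z : ℤ_[p], (z : ℚ_[p]) = x / a := ⟨⟨x / a, h1⟩, rfl⟩
    obtain ⟨n, hn, h⟩ := PadicInt.exists_mem_range z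
    refine ⟨⟨n, hn⟩, ?_⟩
    rw [PadicInt.maximalIdeal_eq_span_p, Ideal.mem_span_singleton] at h
    obtain ⟨y, hy⟩ := h
    have hy' : x / a - n = p * (y : ℚ_[p]) := by
      rw [← hz]
      exact_mod_cast congrArg (fun z : ℤ_[p] => (z : ℚ_[p])) hy
    have h2 : x - n * a = (p * a) * y := by
      field_simp at hy'
      linear_combination hy'
    simp only [h2, norm_mul ((p : ℚ_[p]) * a)]
    exact mul_le_of_le_one_right (norm_nonneg _) y.2
  · rintro ⟨i, hi⟩
    have h1 : ‖(i : ℕ) * a‖ ≤ ‖a‖ := by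
      rw [norm_mul]
      exact mul_le_of_le_one_left (norm_nonneg _) (by exact_mod_cast Padic.norm_int_le_one (p := p) (i : ℕ))
    have h2 : ‖(p : ℚ_[p]) * a‖ ≤ ‖a‖ := by
      rw [norm_mul]
      exact mul_le_of_le_one_left (norm_nonneg _) (by exact_mod_cast Padic.norm_int_le_one (p := p) p)
    have := IsUltrametricDist.norm_add_le_max (x - (i : ℕ) * a) ((i : ℕ) * a)
    rw [sub_add_cancel] at this
    exact this.trans (max_le (hi.trans h2) h1)

theorem haar_closedBall_zero_norm_eq (a : ℚ_[p]) (ha : a ≠ 0) :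
    haar p (closedBall 0 ‖a‖) = p * haar p (closedBall 0 ‖(p : ℚ_[p]) * a‖) := by
  have hp : (p : ℚ_[p]) * a ≠ 0 :=
    mul_ne_zero (Nat.cast_ne_zero.2 (Fact.out (p := p.Prime)).ne_zero) ha
  rw [closedBall_eq_iUnion_closedBall a ha, measure_iUnion]
  · simp [haar_closedBall_center (p := p) (_ * _)]
  · intro i j hij
    rcases IsUltrametricDist.closedBall_eq_or_disjoint ((i : ℕ) * a) ((j : ℕ) * a)
      ‖(p : ℚ_[p]) * a‖ with h | h
    · exfalso
      have h1 : ((i : ℕ) : ℚ_[p]) * a ∈ closedBall ((j : ℕ) * a) ‖(p : ℚ_[p]) * a‖ := by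
        rw [← h]; exact mem_closedBall_self (norm_nonneg _)
      rw [mem_closedBall, dist_eq_norm, ← sub_mul, norm_mul, norm_mul] at h1
      have h2 := le_of_mul_le_mul_right h1 (norm_pos_iff.2 ha)
      have h3 : ‖(((i : ℕ) - (j : ℕ) : ℤ) : ℚ_[p])‖ < 1 := by
        push_cast
        refine h2.trans_lt ?_
        exact_mod_cast Padic.norm_p_lt_one (p := p)
      rw [Padic.norm_intCast_lt_one_iff] at h3
      obtain ⟨k, hk⟩ := h3
      apply hij
      ext
      have hi := i.2
      have hj := j.2
      have : k = 0 := by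
        by_contra hk0
        rcases lt_or_gt_of_ne hk0 with h | h
        · nlinarith
        · nlinarith
      subst this
      omega
    · exact h
  · exact fun i => isClosed_closedBall.measurableSet

/-- The normalized Haar measure of a `p`-adic ball is its radius. -/
theorem haar_closedBall (x a : ℚ_[p]) (ha : a ≠ 0) : haar p (closedBall x ‖a‖) = ‖a‖ₑ := by
  have hp0 : (p : ℚ_[p]) ≠ 0 := Nat.cast_ne_zero.2 (Fact.out (p := p.Prime)).ne_zero
  have hp1 : (p : ℝ≥0∞) * ‖(p : ℚ_[p])‖ₑ = 1 := by
    have hpp : (p : ℝ≥0) ≠ 0 := Nat.cast_ne_zero.2 (Fact.out (p := p.Prime)).ne_zero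
    have h : ‖(p : ℚ_[p])‖₊ = (p : ℝ≥0)⁻¹ := by
      ext; simp [Padic.norm_p]
    rw [enorm_eq_nnnorm, h, ← ENNReal.coe_natCast, ← ENNReal.coe_mul, mul_inv_cancel₀ hpp,
      ENNReal.coe_one]
  -- An equivalence, so that the induction over integer exponents can run both up and down from the
  -- normalization at exponent 0.
  have hstep : ∀ b : ℚ_[p], b ≠ 0 →
      (haar p (closedBall 0 ‖b‖) = ‖b‖ₑ ↔ haar p (closedBall 0 ‖(p : ℚ_[p]) * b‖) = ‖p * b‖ₑ) := by
    intro b hb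
    rw [haar_closedBall_zero_norm_eq b hb]
    have h0 : (p : ℝ≥0∞) ≠ 0 := Nat.cast_ne_zero.2 (Fact.out (p := p.Prime)).ne_zero
    rw [← ENNReal.mul_right_inj h0 (ENNReal.natCast_ne_top p) (c := ‖p * b‖ₑ), enorm_mul, ← mul_assoc, hp1,
      one_mul]
  have hpow : ∀ n : ℤ, haar p (closedBall 0 ‖(p : ℚ_[p]) ^ n‖) = ‖(p : ℚ_[p]) ^ n‖ₑ := by
    intro n
    induction n using Int.induction_on with
    | zero =>
      rw [zpow_zero, norm_one, enorm_one]
      exact Measure.addHaarMeasure_self (K₀ := unitBall p)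
    | succ n ih =>
      rw [hstep _ (zpow_ne_zero _ hp0)] at ih
      rwa [zpow_add_one₀ hp0, mul_comm]
    | pred n ih =>
      rw [hstep _ (zpow_ne_zero _ hp0), ← zpow_one_add₀ hp0, add_sub_cancel]
      exact ih
  obtain ⟨n, hn⟩ : ∃ n : ℤ, ‖a‖ = ‖(p : ℚ_[p]) ^ n‖ :=
    ⟨a.valuation, by rw [Padic.norm_eq_zpow_neg_valuation ha, norm_zpow, Padic.norm_p, inv_zpow, zpow_neg]⟩
  rw [haar_closedBall_center, hn, hpow, enorm_eq_nnnorm, enorm_eq_nnnorm]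
  congr 1
  ext
  exact hn.symm

variable {n : ℕ}

/-- The action of an invertible matrix on column vectors, as an additive homeomorphism. -/
noncomputable def mulVecEquiv (M : GL (Fin n) ℚ_[p]) : (Fin n → ℚ_[p]) ≃ₜ+ (Fin n → ℚ_[p]) where
  toFun := (M : Matrix (Fin n) (Fin n) ℚ_[p]).mulVec
  invFun := ((M⁻¹ : GL (Fin n) ℚ_[p]) : Matrix (Fin n) (Fin n) ℚ_[p]).mulVec
  left_inv x := by rw [Matrix.mulVec_mulVec, ← Units.val_mul]; simp
  right_inv x := by rw [Matrix.mulVec_mulVec, ← Units.val_mul]; simp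
  map_add' := Matrix.mulVec_add _
  continuous_toFun := Continuous.matrix_mulVec continuous_const continuous_id
  continuous_invFun := Continuous.matrix_mulVec continuous_const continuous_id

theorem mulVecEquiv_apply (M : GL (Fin n) ℚ_[p]) (x : Fin n → ℚ_[p]) :
    mulVecEquiv M x = (M : Matrix (Fin n) (Fin n) ℚ_[p]).mulVec x := rfl

/-- The modulus can be read off from a single test set of positive finite measure; boxes serve
below. -/
theorem addEquivAddHaarChar_eq_of_preimage {φ : (Fin n → ℚ_[p]) ≃ₜ+ (Fin n → ℚ_[p])}
    {X : Set (Fin n → ℚ_[p])} {r : ℝ≥0} (h0 : haarPi p n (φ ⁻¹' X) ≠ 0)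
    (h1 : haarPi p n (φ ⁻¹' X) ≠ ∞) (h : haarPi p n X = r * haarPi p n (φ ⁻¹' X)) :
    addEquivAddHaarChar φ = r := by
  have := addEquivAddHaarChar_smul_preimage (haarPi p n) (X := X) φ
  rw [h, ENNReal.smul_def, smul_eq_mul, ENNReal.mul_left_inj h0 h1] at this
  exact_mod_cast this

theorem addEquivAddHaarChar_diagonal (M : GL (Fin n) ℚ_[p]) (d : Fin n → ℚ_[p])
    (hM : (M : Matrix (Fin n) (Fin n) ℚ_[p]) = Matrix.diagonal d) :
    addEquivAddHaarChar (mulVecEquiv M) = ‖(M : Matrix (Fin n) (Fin n) ℚ_[p]).det‖₊ := by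
  have hd : ∀ i, d i ≠ 0 := by
    have h : (M : Matrix (Fin n) (Fin n) ℚ_[p]).det ≠ 0 := M.det.ne_zero
    rw [hM, Matrix.det_diagonal, Finset.prod_ne_zero_iff] at h
    exact fun i => h i (Finset.mem_univ i)
  have hpre : mulVecEquiv M ⁻¹' (univ.pi fun i => closedBall 0 ‖d i‖) =
      univ.pi fun _ => closedBall 0 ‖(1 : ℚ_[p])‖ := by
    ext x
    have : ∀ i, ‖d i * x i‖ ≤ ‖d i‖ ↔ ‖x i‖ ≤ 1 := by
      intro i
      rw [norm_mul, mul_le_iff_le_one_right (norm_pos_iff.2 (hd i))]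
    simp [mulVecEquiv_apply, hM, Matrix.mulVec_diagonal, this, -norm_mul]
  have hbox : haarPi p n (univ.pi fun _ => closedBall 0 ‖(1 : ℚ_[p])‖) = 1 := by
    rw [haarPi, Measure.pi_pi]
    simp [haar_closedBall (p := p) 0 1 one_ne_zero, -norm_one]
  apply addEquivAddHaarChar_eq_of_preimage (X := univ.pi fun i => closedBall 0 ‖d i‖)
  · rw [hpre, hbox]; exact one_ne_zero
  · rw [hpre, hbox]; exact ENNReal.one_ne_top
  · rw [hpre, hbox, haarPi, Measure.pi_pi, hM, Matrix.det_diagonal]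
    simp [haar_closedBall, hd, enorm_eq_nnnorm]

theorem addEquivAddHaarChar_transvection (M : GL (Fin n) ℚ_[p])
    (s : Matrix.TransvectionStruct (Fin n) ℚ_[p])
    (hM : (M : Matrix (Fin n) (Fin n) ℚ_[p]) = s.toMatrix) :
    addEquivAddHaarChar (mulVecEquiv M) = 1 := by
  classical
  obtain ⟨i, j, hij, c⟩ := s
  have hmul : ∀ x : Fin n → ℚ_[p], mulVecEquiv M x = x + Pi.single i (c * x j) := by
    intro x
    rw [mulVecEquiv_apply, hM, Matrix.TransvectionStruct.toMatrix_mk, Matrix.transvection,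
      Matrix.add_mulVec, Matrix.one_mulVec, Matrix.single_mulVec]
    rfl
  -- A box with side max(1, |c|) in direction i and 1 elsewhere absorbs the shear x_i ↦ x_i + c x_j
  -- by the ultrametric inequality, so both the shear and its inverse preserve it.
  let R : Fin n → ℝ := fun k => if k = i then max 1 ‖c‖ else 1
  have hRi : R i = max 1 ‖c‖ := by simp [R]
  have hRj : R j = 1 := by simp [R, hij.symm]
  have hR : ∀ k, 0 < R k := by
    intro k
    by_cases hk : k = i <;> simp [R, hk]
  let X : Set (Fin n → ℚ_[p]) := univ.pi fun k => closedBall 0 (R k)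
  have hX : ∀ (b : ℚ_[p]) (x : Fin n → ℚ_[p]), ‖b‖ = ‖c‖ → x ∈ X →
      x + Pi.single i (b * x j) ∈ X := by
    intro b x hb hx
    simp only [X, mem_univ_pi, mem_closedBall, dist_zero_right] at hx ⊢
    intro k
    by_cases hk : k = i
    · subst hk
      rw [Pi.add_apply, Pi.single_eq_same]
      refine (IsUltrametricDist.norm_add_le_max _ _).trans (max_le (hx k) ?_)
      rw [norm_mul, hb, hRi]
      have := hx j
      rw [hRj] at this
      exact (mul_le_of_le_one_right (norm_nonneg _) this).trans (le_max_right _ _)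
    · simpa [hk] using hx k
  have hpre : mulVecEquiv M ⁻¹' X = X := by
    ext x
    rw [mem_preimage, hmul]
    refine ⟨fun h => ?_, hX c x rfl⟩
    have := hX (-c) _ (norm_neg c) h
    have hj : (x + Pi.single i (c * x j) : Fin n → ℚ_[p]) j = x j := by
      simp [hij.symm]
    rw [hj, add_assoc, ← Pi.single_add] at this
    simpa using this
  have hXc : IsCompact X := isCompact_univ_pi fun k => isCompact_closedBall _ _
  have hX0 : haarPi p n X ≠ 0 := by
    rw [haarPi, Measure.pi_pi, Finset.prod_ne_zero_iff]
    exact fun k _ => (measure_closedBall_pos _ _ (hR k)).ne'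
  apply addEquivAddHaarChar_eq_of_preimage (X := X)
  · rwa [hpre]
  · rw [hpre]; exact hXc.measure_ne_top
  · rw [hpre]; simp

/-- An invertible matrix scales the Haar measure of `ℚ_[p]^n` by the norm of its determinant. -/
theorem addEquivAddHaarChar_mulVecEquiv (M : GL (Fin n) ℚ_[p]) :
    addEquivAddHaarChar (mulVecEquiv M) = ‖(M : Matrix (Fin n) (Fin n) ℚ_[p]).det‖₊ := by
  suffices h : ∀ A : Matrix (Fin n) (Fin n) ℚ_[p], A.det ≠ 0 →
      ∀ M : GL (Fin n) ℚ_[p], (M : Matrix (Fin n) (Fin n) ℚ_[p]) = A →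
      addEquivAddHaarChar (mulVecEquiv M) = ‖A.det‖₊ from h _ M.det.ne_zero M rfl
  intro A hA
  apply Matrix.diagonal_transvection_induction_of_det_ne_zero _ A hA
  · rintro d - M hM
    rw [addEquivAddHaarChar_diagonal M d hM, hM]
  · intro s M hM
    rw [addEquivAddHaarChar_transvection M s hM]
    simp
  · intro A B hA hB ihA ihB M hM
    let MA := Matrix.GeneralLinearGroup.mkOfDetNeZero A hA
    let MB := Matrix.GeneralLinearGroup.mkOfDetNeZero B hB
    have hM' : mulVecEquiv M = (mulVecEquiv MB).trans (mulVecEquiv MA) := by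
      ext x : 1
      change _ = mulVecEquiv MA (mulVecEquiv MB x)
      rw [mulVecEquiv_apply, mulVecEquiv_apply, mulVecEquiv_apply, hM, Matrix.mulVec_mulVec]
      rfl
    rw [hM', addEquivAddHaarChar_trans, ihA MA rfl, ihB MB rfl, Matrix.det_mul, nnnorm_mul,
      mul_comm]

theorem map_mulVec_haarPi (M : GL (Fin n) ℚ_[p])
    (hM : ‖(M : Matrix (Fin n) (Fin n) ℚ_[p]).det‖ = 1) :
    (haarPi p n).map (M : Matrix (Fin n) (Fin n) ℚ_[p]).mulVec = haarPi p n := by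
  have h := addEquivAddHaarChar_smul_map (haarPi p n) (mulVecEquiv M)
  have h1 : ‖(M : Matrix (Fin n) (Fin n) ℚ_[p]).det‖₊ = 1 := by ext; exact hM
  rw [addEquivAddHaarChar_mulVecEquiv, h1, one_smul] at h
  exact h

theorem map_smul_haarPi (u : ℚ_[p]) (hu : ‖u‖ = 1) :
    (haarPi p n).map (fun x => u • x) = haarPi p n := by
  have hu0 : u ≠ 0 := by rw [← norm_pos_iff, hu]; exact one_pos
  have hdet : (Matrix.diagonal fun _ : Fin n => u).det = u ^ n := by simp
  have h := map_mulVec_haarPi (Matrix.GeneralLinearGroup.mkOfDetNeZero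
    (Matrix.diagonal fun _ : Fin n => u) (by rw [hdet]; exact pow_ne_zero _ hu0))
    (by simp [Matrix.GeneralLinearGroup.mkOfDetNeZero, hu])
  convert h using 2
  ext x i
  simp [Matrix.GeneralLinearGroup.mkOfDetNeZero, Matrix.mulVec_diagonal]

end Haar

/-! ### Square roots on 1 + pℤ_p -/

section SquareRoot

open Metric

variable {p : ℕ} [Fact p.Prime]

theorem norm_two (hp : p ≠ 2) : ‖(2 : ℚ_[p])‖ = 1 := by
  rw [show (2 : ℚ_[p]) = ((2 : ℕ) : ℚ_[p]) by norm_num, Padic.norm_natCast_eq_one_iff]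
  exact (Nat.coprime_primes (Fact.out) Nat.prime_two).2 hp

theorem norm_eq_of_norm_sub_lt {E : Type*} [NormedAddCommGroup E] [IsUltrametricDist E] {x y : E}
    (h : ‖x - y‖ < ‖y‖) : ‖x‖ = ‖y‖ := by
  have h1 := IsUltrametricDist.norm_eq_of_add_norm_lt_max (x := x) (y := -y)
  rw [← sub_eq_add_neg, norm_neg] at h1
  exact h1 (h.trans_le (le_max_right _ _))

theorem norm_eq_one_of_norm_sub_one_lt {s : ℚ_[p]} (h : ‖s - 1‖ < 1) : ‖s‖ = 1 := by
  rw [norm_eq_of_norm_sub_lt (by rwa [norm_one]), norm_one]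

theorem norm_add_eq_of_norm_sub_lt (hp : p ≠ 2) {x y : ℚ_[p]} (h : ‖x - y‖ < ‖y‖) :
    ‖x + y‖ = ‖y‖ := by
  have h2 : ‖2 * y‖ = ‖y‖ := by rw [norm_mul, norm_two hp, one_mul]
  rw [← h2]
  apply norm_eq_of_norm_sub_lt
  rwa [h2, show x + y - 2 * y = x - y by ring]

theorem norm_sq_sub_sq (hp : p ≠ 2) {x y : ℚ_[p]} (h : ‖x - y‖ < ‖y‖) :
    ‖x ^ 2 - y ^ 2‖ = ‖x - y‖ * ‖y‖ := by
  rw [sq_sub_sq, norm_mul, norm_add_eq_of_norm_sub_lt hp h, mul_comm]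

theorem norm_sub_lt_one {s u : ℚ_[p]} (hs : ‖s - 1‖ < 1) (hu : ‖u - 1‖ < 1) : ‖s - u‖ < 1 := by
  rw [← sub_add_sub_cancel s 1 u]
  rw [norm_sub_rev] at hu
  exact (IsUltrametricDist.norm_add_le_max _ _).trans_lt (max_lt hs hu)

/-- Here |s + u| = |2| = 1, which is where p ≠ 2 enters: squaring is an isometry of 1 + pℤ_p.
Injectivity of squaring and the isometry property of the root follow. -/
theorem norm_sq_sub_sq_of_near_one (hp : p ≠ 2) {s u : ℚ_[p]} (hs : ‖s - 1‖ < 1)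
    (hu : ‖u - 1‖ < 1) : ‖s ^ 2 - u ^ 2‖ = ‖s - u‖ := by
  have h1 := norm_eq_one_of_norm_sub_one_lt hu
  rw [norm_sq_sub_sq hp, h1, mul_one]
  rw [h1]; exact norm_sub_lt_one hs hu

/-- Hensel's lemma for X² - x at the approximate root 1, where the derivative 2 is a unit. -/
theorem exists_sq_eq_of_norm_sub_one_lt (hp : p ≠ 2) {x : ℚ_[p]} (hx : ‖x - 1‖ < 1) :
    ∃ s : ℚ_[p], ‖s - 1‖ < 1 ∧ s ^ 2 = x := by
  have hx1 := norm_eq_one_of_norm_sub_one_lt hx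
  let z : ℤ_[p] := ⟨x, hx1.le⟩
  have h2 : ‖(2 : ℤ_[p])‖ = 1 := by
    rw [PadicInt.norm_def]; exact norm_two hp
  have hd : ‖Polynomial.aeval (1 : ℤ_[p])
      (Polynomial.derivative (Polynomial.X ^ 2 - Polynomial.C z))‖ = 1 := by
    simp [one_add_one_eq_two, h2]
  have hz : ‖(1 : ℤ_[p]) - z‖ < 1 := by
    rw [PadicInt.norm_def, PadicInt.coe_sub, norm_sub_rev]
    exact hx
  obtain ⟨s, hs, hs1, -⟩ := hensels_lemma (F := Polynomial.X ^ 2 - Polynomial.C z)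
    (a := (1 : ℤ_[p])) (by rw [hd]; simpa using hz)
  rw [hd, PadicInt.norm_def, PadicInt.coe_sub, PadicInt.coe_one] at hs1
  refine ⟨s, hs1, ?_⟩
  have h3 : s ^ 2 = z := by simpa [sub_eq_zero] using hs
  have := congrArg (fun w : ℤ_[p] => (w : ℚ_[p])) h3
  simpa using this

open Classical in
/-- The square root near `1` of a `p`-adic number near `1`, extended by `1`. -/
noncomputable def sqrtOne (x : ℚ_[p]) : ℚ_[p] :=
  if h : ∃ s : ℚ_[p], ‖s - 1‖ < 1 ∧ s ^ 2 = x then h.choose else 1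

theorem norm_sqrtOne_sub_one_lt (x : ℚ_[p]) : ‖sqrtOne x - 1‖ < 1 := by
  rw [sqrtOne]
  split_ifs with h
  · exact h.choose_spec.1
  · simp

theorem norm_sqrtOne (x : ℚ_[p]) : ‖sqrtOne x‖ = 1 :=
  norm_eq_one_of_norm_sub_one_lt (norm_sqrtOne_sub_one_lt x)

theorem sqrtOne_ne_zero (x : ℚ_[p]) : sqrtOne x ≠ 0 := by
  rw [← norm_pos_iff, norm_sqrtOne]; exact one_pos

theorem sqrtOne_sq (hp : p ≠ 2) {x : ℚ_[p]} (hx : ‖x - 1‖ < 1) : sqrtOne x ^ 2 = x := by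
  have h := exists_sq_eq_of_norm_sub_one_lt hp hx
  rw [sqrtOne, dif_pos h]
  exact h.choose_spec.2

theorem norm_sq_sub_one_lt {s : ℚ_[p]} (hs : ‖s - 1‖ < 1) : ‖s ^ 2 - 1‖ < 1 := by
  have h : s ^ 2 - 1 = (s - 1) * (s + 1) := by ring
  have h2 : ‖s + 1‖ ≤ 1 := by
    refine (IsUltrametricDist.norm_add_le_max _ _).trans ?_
    rw [norm_eq_one_of_norm_sub_one_lt hs, norm_one, max_self]
  rw [h, norm_mul]
  exact mul_lt_one_of_nonneg_of_lt_one_left (norm_nonneg _) hs h2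

theorem sqrtOne_sq_self (hp : p ≠ 2) {s : ℚ_[p]} (hs : ‖s - 1‖ < 1) : sqrtOne (s ^ 2) = s := by
  rw [← sub_eq_zero, ← norm_eq_zero,
    ← norm_sq_sub_sq_of_near_one hp (norm_sqrtOne_sub_one_lt _) hs,
    sqrtOne_sq hp (norm_sq_sub_one_lt hs), sub_self, norm_zero]

theorem norm_sqrtOne_sub (hp : p ≠ 2) {x y : ℚ_[p]} (hx : ‖x - 1‖ < 1) (hy : ‖y - 1‖ < 1) :
    ‖sqrtOne x - sqrtOne y‖ = ‖x - y‖ := by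
  rw [← norm_sq_sub_sq_of_near_one hp (norm_sqrtOne_sub_one_lt _) (norm_sqrtOne_sub_one_lt _),
    sqrtOne_sq hp hx, sqrtOne_sq hp hy]

theorem norm_sqrtOne_sub_one (hp : p ≠ 2) {x : ℚ_[p]} (hx : ‖x - 1‖ < 1) :
    ‖sqrtOne x - 1‖ = ‖x - 1‖ := by
  have h1 : sqrtOne (1 : ℚ_[p]) = 1 := by
    simpa using sqrtOne_sq_self (p := p) hp (s := 1) (by simp)
  have := norm_sqrtOne_sub hp hx (y := 1) (by simp)
  rwa [h1] at this

theorem sqrtOne_eq_one_of_not_lt {x : ℚ_[p]} (hx : ¬ ‖x - 1‖ < 1) : sqrtOne x = 1 := by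
  rw [sqrtOne, dif_neg]
  rintro ⟨s, hs, rfl⟩
  exact hx (norm_sq_sub_one_lt hs)

/-- The ball 1 + pℤ_p is clopen, so the default value 1 outside it does no harm. Thus `radius` and
`radial` below are continuous on the whole space and not only on the cone. -/
theorem continuous_sqrtOne (hp : p ≠ 2) : Continuous (sqrtOne : ℚ_[p] → ℚ_[p]) := by
  rw [continuous_iff_continuousAt]
  intro x
  by_cases hx : ‖x - 1‖ < 1
  · rw [Metric.continuousAt_iff]
    intro ε hε
    refine ⟨min ε 1, lt_min hε one_pos, fun {y} hy => ?_⟩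
    rw [dist_eq_norm] at hy ⊢
    have hy1 : ‖y - 1‖ < 1 := by
      rw [← sub_add_sub_cancel y x 1]
      exact (IsUltrametricDist.norm_add_le_max _ _).trans_lt
        (max_lt (hy.trans_le (min_le_right _ _)) hx)
    rw [norm_sqrtOne_sub hp hy1 hx]
    exact hy.trans_le (min_le_left _ _)
  · have hopen : IsOpen {y : ℚ_[p] | ¬ ‖y - 1‖ < 1} := by
      have := (IsUltrametricDist.isClosed_ball (1 : ℚ_[p]) 1).isOpen_compl
      convert this using 1
      ext y
      simp [dist_eq_norm]
    refine (continuousAt_const (y := (1 : ℚ_[p]))).congr ?_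
    filter_upwards [hopen.mem_nhds hx] with y hy
    exact (sqrtOne_eq_one_of_not_lt hy).symm

/-- Squaring, as a homeomorphism of the ball `1 + p ℤ_p`. -/
noncomputable def squareHomeomorph (hp : p ≠ 2) : OpenPartialHomeomorph ℚ_[p] ℚ_[p] where
  toFun s := s ^ 2
  invFun := sqrtOne
  source := ball 1 1
  target := ball 1 1
  map_source' s hs := by
    rw [mem_ball, dist_eq_norm] at *
    exact norm_sq_sub_one_lt hs
  map_target' x _ := by
    rw [mem_ball, dist_eq_norm]
    exact norm_sqrtOne_sub_one_lt x
  left_inv' s hs := by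
    rw [mem_ball, dist_eq_norm] at hs
    exact sqrtOne_sq_self hp hs
  right_inv' x hx := by
    rw [mem_ball, dist_eq_norm] at hx
    exact sqrtOne_sq hp hx
  open_source := isOpen_ball
  open_target := isOpen_ball
  continuousOn_toFun := (continuous_pow 2).continuousOn
  continuousOn_invFun := (continuous_sqrtOne hp).continuousOn

/-- Analytic inverse function theorem for squaring, whose derivative 2 √x does not vanish. -/
theorem analyticAt_sqrtOne (hp : p ≠ 2) {x : ℚ_[p]} (hx : ‖x - 1‖ < 1) :
    AnalyticAt ℚ_[p] (sqrtOne : ℚ_[p] → ℚ_[p]) x := by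
  have h2 : (2 : ℚ_[p]) * sqrtOne x ≠ 0 := mul_ne_zero two_ne_zero (sqrtOne_ne_zero x)
  refine (squareHomeomorph hp).analyticAt_symm (a := x)
    (i := ContinuousLinearEquiv.unitsEquivAut ℚ_[p] (Units.mk0 _ h2)) ?_ ?_ ?_
  · simpa [squareHomeomorph, dist_eq_norm] using hx
  · exact analyticAt_id.pow 2
  · change fderiv ℚ_[p] (fun s : ℚ_[p] => s ^ 2) (sqrtOne x) = _
    ext
    simp

end SquareRoot

/-! ### Comparing measures through their values on balls -/

theorem measure_ext_of_locally_eq {X : Type*} [TopologicalSpace X] [MeasurableSpace X]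
    [SecondCountableTopology X] {μ ν : Measure X}
    (h : ∀ x, ∃ U ∈ nhds x, μ.restrict U = ν.restrict U) : μ = ν := by
  choose U hU hμν using h
  obtain ⟨s, hs, hsU⟩ := TopologicalSpace.countable_cover_nhds hU
  exact (Measure.ext_iff_of_biUnion_eq_univ hs hsU).2 fun x _ => hμν x

section UniformlyDistributed

open Metric

variable {X : Type*} [MetricSpace X] [MeasurableSpace X] [BorelSpace X]
  [SecondCountableTopology X]

/-- Two measures for each of which almost all balls of radius `r` have the same measure have
proportional values on these balls. -/
theorem measure_univ_mul_eq_of_ae_measure_closedBall (μ ν : Measure X) [SFinite μ] [SFinite ν]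
    {r : ℝ} {a b : ℝ≥0∞} (hμ : ∀ᵐ x ∂ν, μ (closedBall x r) = a)
    (hν : ∀ᵐ x ∂μ, ν (closedBall x r) = b) : μ univ * b = ν univ * a := by
  have hs : MeasurableSet {q : X × X | dist q.2 q.1 ≤ r} :=
    (isClosed_le (continuous_snd.dist continuous_fst) continuous_const).measurableSet
  -- The set of pairs at distance at most r is symmetric; its product measure is computed by slicing
  -- in either order, and the slices are balls.
  have key := lintegral_lintegral_swap (μ := μ) (ν := ν)
    (f := fun x y => ({q : X × X | dist q.2 q.1 ≤ r}.indicator 1 (x, y) : ℝ≥0∞))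
    ((measurable_one.indicator hs).aemeasurable)
  have h1 : ∀ x, ∫⁻ y, ({q : X × X | dist q.2 q.1 ≤ r}.indicator 1 (x, y) : ℝ≥0∞) ∂ν =
      ν (closedBall x r) := by
    intro x
    rw [← lintegral_indicator_one isClosed_closedBall.measurableSet]
    rfl
  have h2 : ∀ y, ∫⁻ x, ({q : X × X | dist q.2 q.1 ≤ r}.indicator 1 (x, y) : ℝ≥0∞) ∂μ =
      μ (closedBall y r) := by
    intro y
    rw [← lintegral_indicator_one isClosed_closedBall.measurableSet]
    congr 1
    ext x
    simp [indicator, dist_comm]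
  simp only [h1, h2] at key
  rw [lintegral_congr_ae hν, lintegral_congr_ae hμ, lintegral_const, lintegral_const] at key
  rw [mul_comm, key, mul_comm]

/-- Ultrametric balls are nested or disjoint, so together with ∅ they form a π-system, which
generates the Borel sets. -/
theorem restrict_closedBall_eq_of_forall_closedBall_eq [IsUltrametricDist X] {μ ν : Measure X}
    {x₀ : X} {r₀ : ℝ} (hr₀ : 0 < r₀) (hfin : μ (closedBall x₀ r₀) ≠ ∞)
    (h : ∀ z ∈ closedBall x₀ r₀, ∀ r, 0 < r → r ≤ r₀ →
      μ (closedBall z r) = ν (closedBall z r)) :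
    μ.restrict (closedBall x₀ r₀) = ν.restrict (closedBall x₀ r₀) := by
  let C : Set (Set X) := {s | s = ∅ ∨ ∃ z r, 0 < r ∧ s = closedBall z r}
  have hmeas : ∀ s ∈ C, MeasurableSet s := by
    rintro s (rfl | ⟨z, r, -, rfl⟩)
    · exact MeasurableSet.empty
    · exact isClosed_closedBall.measurableSet
  have hbasis : TopologicalSpace.IsTopologicalBasis C := by
    refine TopologicalSpace.isTopologicalBasis_of_isOpen_of_nhds ?_ ?_
    · rintro s (rfl | ⟨z, r, hr, rfl⟩)
      · exact isOpen_empty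
      · exact IsUltrametricDist.isOpen_closedBall _ hr.ne'
    · intro z u hz hu
      obtain ⟨r, hr, hru⟩ := Metric.nhds_basis_closedBall.mem_iff.1 (hu.mem_nhds hz)
      exact ⟨_, Or.inr ⟨z, r, hr, rfl⟩, mem_closedBall_self hr.le, hru⟩
  have hpi : IsPiSystem C := by
    rintro s (rfl | ⟨z, r, hr, rfl⟩) u (rfl | ⟨w, q, hq, rfl⟩) -
    · exact Or.inl (by simp)
    · exact Or.inl (by simp)
    · exact Or.inl (by simp)
    · rcases IsUltrametricDist.closedBall_subset_trichotomy z w r q with h | h | h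
      · exact Or.inr ⟨z, r, hr, inter_eq_left.2 h⟩
      · exact Or.inr ⟨w, q, hq, inter_eq_right.2 h⟩
      · exact Or.inl (disjoint_iff_inter_eq_empty.1 h)
  have : IsFiniteMeasure (μ.restrict (closedBall x₀ r₀)) :=
    ⟨by simpa using lt_top_iff_ne_top.2 hfin⟩
  have huniv : μ (closedBall x₀ r₀) = ν (closedBall x₀ r₀) :=
    h x₀ (mem_closedBall_self hr₀.le) r₀ hr₀ le_rfl
  refine ext_of_generate_finite C ?_ hpi ?_ (by simpa using huniv)
  · rw [BorelSpace.measurable_eq (α := X), hbasis.borel_eq_generateFrom]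
  · intro s hs
    rw [Measure.restrict_apply (hmeas s hs), Measure.restrict_apply (hmeas s hs)]
    rcases hs with rfl | ⟨z, r, hr, rfl⟩
    · simp
    · rcases IsUltrametricDist.closedBall_subset_trichotomy z x₀ r r₀ with h' | h' | h'
      · rw [inter_eq_left.2 h']
        rcases le_or_gt r r₀ with hrr | hrr
        · exact h z (h' (mem_closedBall_self hr.le)) r hr hrr
        -- A ball of nominal radius above r₀ may still lie inside the r₀-ball; it then coincides
        -- with it.
        · have : closedBall z r = closedBall x₀ r₀ := by
            refine h'.antisymm ?_
            rw [IsUltrametricDist.closedBall_eq_of_mem (h' (mem_closedBall_self hr.le))]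
            exact closedBall_subset_closedBall hrr.le
          rw [this, huniv]
      · rw [inter_eq_right.2 h', huniv]
      · rw [disjoint_iff_inter_eq_empty.1 h']
        simp

end UniformlyDistributed

/-! ### Gel'fand-Leray forms and their densities in graph charts -/

section Forms

variable {p : ℕ} [Fact p.Prime]

theorem hasFDerivAt_Q (k : Fin 4 → ℚ_[p]) :
    HasFDerivAt (Q : (Fin 4 → ℚ_[p]) → ℚ_[p])
      ((2 : ℚ_[p]) • (k 0 • ContinuousLinearMap.proj 0 - k 1 • ContinuousLinearMap.proj 1
        - k 2 • ContinuousLinearMap.proj 2 - k 3 • ContinuousLinearMap.proj 3 :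
          (Fin 4 → ℚ_[p]) →L[ℚ_[p]] ℚ_[p])) k := by
  have h : ∀ i : Fin 4, HasFDerivAt (fun x : Fin 4 → ℚ_[p] => x i)
      (ContinuousLinearMap.proj i : (Fin 4 → ℚ_[p]) →L[ℚ_[p]] ℚ_[p]) k := fun i =>
    (ContinuousLinearMap.proj (R := ℚ_[p]) (φ := fun _ : Fin 4 => ℚ_[p]) i).hasFDerivAt
  have := ((((h 0).mul (h 0)).sub ((h 1).mul (h 1))).sub ((h 2).mul (h 2))).sub
    ((h 3).mul (h 3))
  refine (this.congr_fderiv ?_)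
  ext v
  simp
  ring

theorem fderiv_Q_apply (k v : Fin 4 → ℚ_[p]) : fderiv ℚ_[p] Q k v = 2 * bilin k v := by
  rw [(hasFDerivAt_Q k).fderiv]
  simp [bilin]

theorem continuous_Q : Continuous (Q : (Fin 4 → ℚ_[p]) → ℚ_[p]) := by
  unfold Q bilin
  fun_prop

theorem isClosed_V (t : ℚ_[p]) : IsClosed (V t) :=
  isClosed_eq continuous_Q continuous_const

theorem Q_smul (s : ℚ_[p]) (k : Fin 4 → ℚ_[p]) : Q (s • k) = s ^ 2 * Q k := by
  simp only [Q, bilin, Pi.smul_apply, smul_eq_mul]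
  ring

theorem norm_fderiv_Q_single (hp : p ≠ 2) (k : Fin 4 → ℚ_[p]) (l : Fin 4) :
    ‖fderiv ℚ_[p] Q k (Pi.single l 1)‖ = ‖k l‖ := by
  rw [fderiv_Q_apply, norm_mul, norm_two hp, one_mul]
  fin_cases l <;> simp [bilin]

/-- The determinant of four vectors, as a continuous alternating form. -/
noncomputable def detForm (p : ℕ) [Fact p.Prime] :
    (Fin 4 → ℚ_[p]) [⋀^Fin 4]→L[ℚ_[p]] ℚ_[p] where
  toMultilinearMap := (Matrix.detRowAlternating (n := Fin 4) (R := ℚ_[p])).toMultilinearMap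
  map_eq_zero_of_eq' := (Matrix.detRowAlternating (n := Fin 4) (R := ℚ_[p])).map_eq_zero_of_eq'
  cont := Continuous.matrix_det (A := fun v : Fin 4 → Fin 4 → ℚ_[p] => Matrix.of v) continuous_id

/-- The contraction of the volume form with the Euler field, divided by `2 t`. -/
noncomputable def eulerForm (t : ℚ_[p]) (k : Fin 4 → ℚ_[p]) :
    (Fin 4 → ℚ_[p]) [⋀^Fin 3]→L[ℚ_[p]] ℚ_[p] :=
  ((2 * t)⁻¹ • (detForm p).curryLeft) k

/-- Cramer's rule, paired with a linear form `a`. -/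
theorem dotProduct_mul_det_eq_sum (a k : Fin 4 → ℚ_[p]) (v : Fin 4 → Fin 4 → ℚ_[p]) :
    a ⬝ᵥ k * (Matrix.of v).det = ∑ i : Fin 4, (-1) ^ (i : ℕ) * a ⬝ᵥ v i *
      (Matrix.of (Fin.cons k fun j : Fin 3 => v (i.succAbove j) : Fin 4 → Fin 4 → ℚ_[p])).det := by
  let w : Fin 5 → Fin 4 → ℚ_[p] := Fin.cons k v
  -- The first column is the combination of the other four with coefficients `a`, so the determinant
  -- vanishes; expanding along that column gives the identity.
  let M : Matrix (Fin 5) (Fin 5) ℚ_[p] := Matrix.of fun j => Fin.cons (a ⬝ᵥ w j) (w j)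
  have hM : M.det = 0 := by
    rw [← Matrix.exists_mulVec_eq_zero_iff]
    refine ⟨Fin.cons 1 (-a), fun h => ?_, ?_⟩
    · simpa using congrFun h 0
    · ext j
      simp [M, Matrix.mulVec, dotProduct, Fin.sum_univ_succ, mul_comm]
      ring
  rw [Matrix.det_succ_column_zero, Fin.sum_univ_succ] at hM
  have h0 : M.submatrix (Fin.succAbove 0) Fin.succ = Matrix.of v := by
    ext i j
    simp [M, w]
  have hs : ∀ i : Fin 4, M.submatrix (Fin.succAbove i.succ) Fin.succ =
      Matrix.of (Fin.cons k fun j : Fin 3 => v (i.succAbove j) : Fin 4 → Fin 4 → ℚ_[p]) := by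
    intro i
    ext j l
    refine Fin.cases ?_ (fun j => ?_) j <;> simp [M, w]
  rw [h0, ← eq_neg_iff_add_eq_zero, ← Finset.sum_neg_distrib] at hM
  simp only [hs] at hM
  rw [← show (-1) ^ ((0 : Fin 5) : ℕ) * M 0 0 = a ⬝ᵥ k by simp [M, w], hM]
  refine Finset.sum_congr rfl fun i _ => ?_
  simp only [M, w, Fin.val_succ, Matrix.of_apply, Fin.cons_succ, Fin.cons_zero]
  ring

theorem isGelfandLerayForm_eulerForm {t : ℚ_[p]} (ht : t ≠ 0) :
    IsGelfandLerayForm t (eulerForm t) where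
  analytic := fun k _ => ContinuousLinearMap.analyticAt ((2 * t)⁻¹ • (detForm p).curryLeft) k
  wedge_eq := by
    intro k hk v
    have h2 : (2 : ℚ_[p]) ≠ 0 := two_ne_zero
    have hω : ∀ u : Fin 3 → Fin 4 → ℚ_[p], eulerForm t k u =
      (2 * t)⁻¹ * (Matrix.of (Fin.cons k u : Fin 4 → Fin 4 → ℚ_[p])).det := fun u => rfl
    let a : Fin 4 → ℚ_[p] := ![k 0, -k 1, -k 2, -k 3]
    have ha : ∀ x, bilin k x = a ⬝ᵥ x := by
      intro x
      simp [a, bilin, dotProduct, Fin.sum_univ_four]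
      ring
    have hk' : a ⬝ᵥ k = t := by
      rw [← ha]; exact hk
    have key := dotProduct_mul_det_eq_sum a k v
    rw [hk'] at key
    simp only [wedge, hω, fderiv_Q_apply, ha]
    rw [eq_comm, ← mul_right_inj' ht, key, Finset.mul_sum]
    refine Finset.sum_congr rfl fun i _ => ?_
    field_simp

/-- The derivative of the parametrization of a graph chart. -/
noncomputable def GraphChart.paramDeriv {t : ℚ_[p]} (c : GraphChart t) (y : Fin 3 → ℚ_[p]) :
    (Fin 3 → ℚ_[p]) →L[ℚ_[p]] (Fin 4 → ℚ_[p]) :=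
  ContinuousLinearMap.pi (c.l.insertNth (fderiv ℚ_[p] c.h y)
    (fun i => ContinuousLinearMap.proj i) :
      Fin 4 → ((Fin 3 → ℚ_[p]) →L[ℚ_[p]] ℚ_[p]))

theorem GraphChart.paramDeriv_apply {t : ℚ_[p]} (c : GraphChart t) (y v : Fin 3 → ℚ_[p]) :
    c.paramDeriv y v = c.l.insertNth (fderiv ℚ_[p] c.h y v) v := by
  ext j
  induction j using c.l.succAboveCases <;> simp [GraphChart.paramDeriv]

theorem GraphChart.hasFDerivAt_param {t : ℚ_[p]} (c : GraphChart t) {y : Fin 3 → ℚ_[p]}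
    (hy : y ∈ c.W) : HasFDerivAt c.param (c.paramDeriv y) y := by
  rw [hasFDerivAt_pi']
  intro j
  induction j using c.l.succAboveCases with
  | x =>
    have := (c.analytic y hy).differentiableAt.hasFDerivAt
    convert this using 1
    · ext z; simp [GraphChart.param]
    · ext v; simp [GraphChart.paramDeriv]
  | p i =>
    have h1 : (fun x => c.param x (c.l.succAbove i)) = fun x => x i := by
      ext z; simp [GraphChart.param]
    have h2 : (ContinuousLinearMap.proj (c.l.succAbove i)).comp (c.paramDeriv y) =
        (ContinuousLinearMap.proj i : (Fin 3 → ℚ_[p]) →L[ℚ_[p]] ℚ_[p]) := by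
      ext v; simp [GraphChart.paramDeriv]
    rw [h1, h2]
    exact hasFDerivAt_apply i y

/-- Expanding along the first row, a basis vector, leaves the identity matrix; the entries `a` never
contribute. -/
theorem det_cons_single_insertNth (l : Fin 4) (a : Fin 3 → ℚ_[p]) :
    ‖(Matrix.of (Fin.cons (Pi.single l 1)
      (fun i : Fin 3 => l.insertNth (a i) (Pi.single i 1)) : Fin 4 → Fin 4 → ℚ_[p])).det‖ = 1 := by
  rw [Matrix.det_succ_row_zero, Finset.sum_eq_single l]
  · have : (Matrix.of (Fin.cons (Pi.single l 1) (fun i : Fin 3 => l.insertNth (a i) (Pi.single i 1)) :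
        Fin 4 → Fin 4 → ℚ_[p])).submatrix Fin.succ l.succAbove = 1 := by
      ext i j
      simp [Matrix.one_apply, Pi.single_apply, eq_comm]
    rw [this]
    simp
  · intro j _ hj
    simp [hj]
  · simp

/-- In a graph chart every Gel'fand-Leray form has the density `1 / |k_l|`. -/
theorem IsGelfandLerayForm.norm_pullback (hp : p ≠ 2) {t : ℚ_[p]}
    {ω : (Fin 4 → ℚ_[p]) → (Fin 4 → ℚ_[p]) [⋀^Fin 3]→L[ℚ_[p]] ℚ_[p]}
    (hω : IsGelfandLerayForm t ω) (c : GraphChart t) {y : Fin 3 → ℚ_[p]} (hy : y ∈ c.W) :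
    ‖ω (c.param y) (fun i : Fin 3 => fderiv ℚ_[p] c.param y (Pi.single i 1))‖ = ‖c.h y‖⁻¹ := by
  have hd := c.hasFDerivAt_param hy
  have hQ : ∀ v, fderiv ℚ_[p] Q (c.param y) (fderiv ℚ_[p] c.param y v) = 0 := by
    intro v
    have h1 : HasFDerivAt (fun z => Q (c.param z))
        ((fderiv ℚ_[p] Q (c.param y)).comp (c.paramDeriv y)) y :=
      (hasFDerivAt_Q (c.param y)).differentiableAt.hasFDerivAt.comp y hd
    have h2 : HasFDerivAt (fun z => Q (c.param z))
        (0 : (Fin 3 → ℚ_[p]) →L[ℚ_[p]] ℚ_[p]) y := by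
      refine (hasFDerivAt_const t y).congr_of_eventuallyEq ?_
      filter_upwards [c.isOpen_W.mem_nhds hy] with z hz
      exact c.mem_V z hz
    rw [hd.fderiv]
    exact congrArg (fun L : (Fin 3 → ℚ_[p]) →L[ℚ_[p]] ℚ_[p] => L v) (h1.unique h2)
  -- Evaluated on the l-th basis vector and the three tangent vectors, the wedge keeps only its
  -- first term, dQ(e_l) times the pull-back, because dQ kills tangent vectors. The left side is ±1,
  -- and |dQ(e_l)| = |2 k_l| = |k_l|.
  have hw := hω.wedge_eq (c.param y) (c.mem_V y hy)
    (Fin.cons (Pi.single c.l 1) fun i : Fin 3 => fderiv ℚ_[p] c.param y (Pi.single i 1))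
  rw [wedge, Fin.sum_univ_succ, Finset.sum_eq_zero] at hw
  · have hdet := det_cons_single_insertNth c.l (fun i => fderiv ℚ_[p] c.h y (Pi.single i 1))
    simp only [← c.paramDeriv_apply, ← hd.fderiv] at hdet
    rw [hw, add_zero] at hdet
    simp only [Fin.val_zero, pow_zero, one_mul, Fin.cons_zero, norm_mul,
      norm_fderiv_Q_single hp, Fin.zero_succAbove, Fin.cons_succ] at hdet
    rw [show c.param y c.l = c.h y by simp [GraphChart.param]] at hdet
    exact eq_inv_of_mul_eq_one_right hdet
  · intro i _
    simp [hQ]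

theorem GraphChart.h_ne_zero (hp : p ≠ 2) {t : ℚ_[p]} (c : GraphChart t) {y : Fin 3 → ℚ_[p]}
    (hy : y ∈ c.W) : c.h y ≠ 0 := by
  have := c.partial_ne_zero y hy
  rw [← norm_pos_iff, norm_fderiv_Q_single hp] at this
  simpa using this

theorem IsGelfandLerayForm.lintegral_pullback (hp : p ≠ 2) {t : ℚ_[p]}
    {ω : (Fin 4 → ℚ_[p]) → (Fin 4 → ℚ_[p]) [⋀^Fin 3]→L[ℚ_[p]] ℚ_[p]}
    (hω : IsGelfandLerayForm t ω) (c : GraphChart t) {B : Set (Fin 3 → ℚ_[p])}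
    (hB : B ⊆ c.W) (hBm : MeasurableSet B) :
    ∫⁻ y in B, ‖ω (c.param y) (fun i : Fin 3 => fderiv ℚ_[p] c.param y (Pi.single i 1))‖ₑ
      ∂(haarPi p 3) = ∫⁻ y in B, ‖c.h y‖ₑ⁻¹ ∂(haarPi p 3) := by
  refine setLIntegral_congr_fun hBm fun y hy => ?_
  have h0 : ‖c.h y‖₊ ≠ 0 := nnnorm_ne_zero_iff.2 (c.h_ne_zero hp (hB hy))
  change _ = ‖c.h y‖ₑ⁻¹
  rw [enorm_eq_nnnorm, enorm_eq_nnnorm, ← ENNReal.coe_inv h0]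
  congr 1
  ext
  exact hω.norm_pullback hp c (hB hy)

end Forms

/-! ### The cone over V_t and its radial measure -/

section Existence

open Metric

variable {p : ℕ} [Fact p.Prime]

theorem exists_Q_eq (t : ℚ_[p]) : ∃ k : Fin 4 → ℚ_[p], Q k = t := by
  have h2 : (2 : ℚ_[p]) ≠ 0 := two_ne_zero
  refine ⟨![(t + 1) / 2, (t - 1) / 2, 0, 0], ?_⟩
  simp [Q, bilin]
  field_simp
  ring

theorem continuous_act (Λ : GL (Fin 4) ℚ_[p]) : Continuous (act Λ) :=
  (mulVecEquiv Λ).continuous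

theorem act_smul (Λ : GL (Fin 4) ℚ_[p]) (s : ℚ_[p]) (k : Fin 4 → ℚ_[p]) :
    act Λ (s • k) = s • act Λ k :=
  Matrix.mulVec_smul _ _ _

theorem Q_act {Λ : GL (Fin 4) ℚ_[p]} (hΛ : Λ ∈ orthogonalGroup p) (k : Fin 4 → ℚ_[p]) :
    Q (act Λ k) = Q k :=
  hΛ k k

/-- With J the Gram matrix, Λᵀ J Λ = J forces det Λ² = 1. -/
theorem norm_det_of_mem_orthogonalGroup {Λ : GL (Fin 4) ℚ_[p]} (hΛ : Λ ∈ orthogonalGroup p) :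
    ‖(Λ : Matrix (Fin 4) (Fin 4) ℚ_[p]).det‖ = 1 := by
  let A : Matrix (Fin 4) (Fin 4) ℚ_[p] := Λ
  let J : Matrix (Fin 4) (Fin 4) ℚ_[p] := Matrix.diagonal ![1, -1, -1, -1]
  have hA : A.transpose * J * A = J := by
    ext i j
    have h : bilin (act Λ (Pi.single i 1)) (act Λ (Pi.single j 1)) =
      bilin (Pi.single i 1) (Pi.single j 1) := hΛ _ _
    have h1 : ∀ m n, act Λ (Pi.single m 1) n = A n m := by
      intro m n
      simp [act, A]
    have h2 : bilin (Pi.single i 1) (Pi.single j (1 : ℚ_[p])) = J i j := by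
      fin_cases i <;> fin_cases j <;> simp [bilin, J]
    rw [h2] at h
    rw [← h]
    simp only [bilin, h1, Matrix.mul_apply, Fin.sum_univ_four, Matrix.transpose_apply, J]
    simp [Matrix.diagonal]
    ring
  have hJ : J.det ≠ 0 := by
    simp [J, Matrix.det_diagonal, Fin.prod_univ_four]
  have hdet := congrArg Matrix.det hA
  rw [Matrix.det_mul, Matrix.det_mul, Matrix.det_transpose, mul_right_comm,
    mul_eq_right₀ hJ] at hdet
  have := congrArg norm hdet
  rw [norm_mul, norm_one] at this
  nlinarith [norm_nonneg A.det]

/-- The cone `{s k : s ∈ 1 + p ℤ_p, k ∈ V_t}`. -/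
def cone (t : ℚ_[p]) : Set (Fin 4 → ℚ_[p]) := {k | ‖Q k / t - 1‖ < 1}

/-- The radius of a point of the cone over `V_t`. -/
noncomputable def radius (t : ℚ_[p]) (k : Fin 4 → ℚ_[p]) : ℚ_[p] := sqrtOne (Q k / t)

/-- The projection of the cone over `V_t` to `V_t` along rays. -/
noncomputable def radial (t : ℚ_[p]) (k : Fin 4 → ℚ_[p]) : Fin 4 → ℚ_[p] :=
  (radius t k)⁻¹ • k

variable {t : ℚ_[p]}

theorem radius_ne_zero (k : Fin 4 → ℚ_[p]) : radius t k ≠ 0 := sqrtOne_ne_zero _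

theorem continuous_radius (hp : p ≠ 2) (t : ℚ_[p]) : Continuous (radius t) :=
  (continuous_sqrtOne hp).comp (continuous_Q.div_const t)

theorem continuous_radial (hp : p ≠ 2) (t : ℚ_[p]) : Continuous (radial t) :=
  ((continuous_radius hp t).inv₀ radius_ne_zero).smul continuous_id

theorem isOpen_cone (t : ℚ_[p]) : IsOpen (cone t) :=
  isOpen_lt ((continuous_Q.div_const t).sub continuous_const).norm continuous_const

theorem radius_smul_radial (t : ℚ_[p]) (k : Fin 4 → ℚ_[p]) : radius t k • radial t k = k := by
  rw [radial, smul_inv_smul₀ (radius_ne_zero k)]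

theorem norm_radial (t : ℚ_[p]) (k : Fin 4 → ℚ_[p]) : ‖radial t k‖ = ‖k‖ := by
  rw [radial, norm_smul, norm_inv, radius, norm_sqrtOne, inv_one, one_mul]

theorem Q_eq_of_mem_cone (hp : p ≠ 2) (ht : t ≠ 0) {k : Fin 4 → ℚ_[p]} (hk : k ∈ cone t) :
    Q k = radius t k ^ 2 * t := by
  rw [radius, sqrtOne_sq hp hk, div_mul_cancel₀ _ ht]

theorem radial_mem_V (hp : p ≠ 2) (ht : t ≠ 0) {k : Fin 4 → ℚ_[p]} (hk : k ∈ cone t) :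
    radial t k ∈ V t := by
  change Q _ = t
  rw [radial, Q_smul, Q_eq_of_mem_cone hp ht hk, ← mul_assoc, inv_pow,
    inv_mul_cancel₀ (pow_ne_zero 2 (radius_ne_zero k)), one_mul]

theorem smul_mem_cone {u : ℚ_[p]} (hu : ‖u - 1‖ < 1) {k : Fin 4 → ℚ_[p]} (hk : k ∈ cone t) :
    u • k ∈ cone t := by
  change ‖Q k / t - 1‖ < 1 at hk
  change ‖Q (u • k) / t - 1‖ < 1
  rw [Q_smul, mul_div_assoc,
    show u ^ 2 * (Q k / t) - 1 = u ^ 2 * (Q k / t - 1) + (u ^ 2 - 1) by ring]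
  refine (IsUltrametricDist.norm_add_le_max _ _).trans_lt (max_lt ?_ (norm_sq_sub_one_lt hu))
  rwa [norm_mul, norm_pow, norm_eq_one_of_norm_sub_one_lt hu, one_pow, one_mul]

theorem norm_inv_sub_one {u : ℚ_[p]} (hu : ‖u - 1‖ < 1) : ‖u⁻¹ - 1‖ = ‖u - 1‖ := by
  have h1 := norm_eq_one_of_norm_sub_one_lt hu
  have h0 : u ≠ 0 := by rw [← norm_pos_iff, h1]; exact one_pos
  rw [show u⁻¹ - 1 = u⁻¹ * (1 - u) by field_simp, norm_mul, norm_inv, h1, inv_one, one_mul,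
    norm_sub_rev]

theorem smul_mem_cone_iff {u : ℚ_[p]} (hu : ‖u - 1‖ < 1) {k : Fin 4 → ℚ_[p]} :
    u • k ∈ cone t ↔ k ∈ cone t := by
  refine ⟨fun h => ?_, smul_mem_cone hu⟩
  have h0 : u ≠ 0 := by
    rw [← norm_pos_iff, norm_eq_one_of_norm_sub_one_lt hu]; exact one_pos
  have := smul_mem_cone (u := u⁻¹) (by rwa [norm_inv_sub_one hu]) h
  rwa [inv_smul_smul₀ h0] at this

theorem radius_smul (hp : p ≠ 2) {u : ℚ_[p]} (hu : ‖u - 1‖ < 1)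
    {k : Fin 4 → ℚ_[p]} (hk : k ∈ cone t) : radius t (u • k) = u * radius t k := by
  have h : Q (u • k) / t = (u * radius t k) ^ 2 := by
    rw [Q_smul, mul_pow, radius, sqrtOne_sq hp hk, mul_div_assoc]
  rw [radius, h, sqrtOne_sq_self hp]
  have hk1 := norm_sqrtOne_sub_one_lt (Q k / t)
  rw [show u * radius t k - 1 = u * (radius t k - 1) + (u - 1) by ring]
  refine (IsUltrametricDist.norm_add_le_max _ _).trans_lt (max_lt ?_ hu)
  rwa [norm_mul, norm_eq_one_of_norm_sub_one_lt hu, one_mul]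

theorem radial_smul (hp : p ≠ 2) {u : ℚ_[p]} (hu : ‖u - 1‖ < 1)
    {k : Fin 4 → ℚ_[p]} (hk : k ∈ cone t) : radial t (u • k) = radial t k := by
  have h0 : u ≠ 0 := by
    rw [← norm_pos_iff, norm_eq_one_of_norm_sub_one_lt hu]; exact one_pos
  rw [radial, radius_smul hp hu hk, smul_smul, mul_inv, mul_right_comm, inv_mul_cancel₀ h0,
    one_mul, radial]

/-- The Gel'fand-Leray measure, as the normalized push-forward of the Haar measure of the cone over
`V_t`. -/
noncomputable def leray (t : ℚ_[p]) : Measure (Fin 4 → ℚ_[p]) :=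
  (haar p (ball 1 1) * ‖t‖ₑ)⁻¹ • ((haarPi p 4).restrict (cone t)).map (radial t)

theorem leray_apply (hp : p ≠ 2) {A : Set (Fin 4 → ℚ_[p])} (hA : MeasurableSet A) :
    leray t A = (haar p (ball 1 1) * ‖t‖ₑ)⁻¹ * haarPi p 4 (radial t ⁻¹' A ∩ cone t) := by
  have hm := (continuous_radial hp t).measurable
  rw [leray, Measure.smul_apply, smul_eq_mul, Measure.map_apply hm hA,
    Measure.restrict_apply (hm hA)]

theorem haar_ball_ne_zero : haar p (ball 1 1) ≠ 0 := (measure_ball_pos _ _ one_pos).ne'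

theorem haar_ball_ne_top : haar p (ball 1 1) ≠ ∞ := measure_ball_lt_top.ne

theorem enorm_ne_zero_of_ne_zero {a : ℚ_[p]} (ha : a ≠ 0) : ‖a‖ₑ ≠ 0 := by simpa using ha

theorem isInvariantMeasure_leray (hp : p ≠ 2) (ht : t ≠ 0) : IsInvariantMeasure t (leray t) where
  supported := by
    rw [leray_apply hp (isClosed_V t).measurableSet.compl]
    have : radial t ⁻¹' (V t)ᶜ ∩ cone t = ∅ := by
      ext k
      simp only [mem_inter_iff, mem_preimage, mem_compl_iff, mem_empty_iff_false, iff_false,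
        not_and]
      exact fun h hk => h (radial_mem_V hp ht hk)
    rw [this, measure_empty, mul_zero]
  finite_on_compacts := by
    intro K hK
    rw [leray_apply hp hK.isClosed.measurableSet]
    refine ENNReal.mul_lt_top ?_ ?_
    · rw [ENNReal.inv_lt_top]
      exact pos_iff_ne_zero.2 (mul_ne_zero haar_ball_ne_zero (enorm_ne_zero_of_ne_zero ht))
    · obtain ⟨R, hR⟩ := hK.isBounded.subset_closedBall 0
      refine (measure_mono (t := closedBall 0 R) ?_).trans_lt measure_closedBall_lt_top
      rintro k ⟨hk, -⟩
      have := hR hk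
      rw [mem_closedBall, dist_zero_right] at *
      rwa [norm_radial] at this
  ne_zero := by
    intro h
    have h1 := leray_apply (t := t) hp MeasurableSet.univ
    rw [h, preimage_univ, univ_inter] at h1
    obtain ⟨k, hk⟩ := exists_Q_eq t
    have hpos := (isOpen_cone t).measure_pos (haarPi p 4) ⟨k, by simp [cone, hk, div_self ht]⟩
    rw [Measure.coe_zero, Pi.zero_apply, eq_comm, mul_eq_zero, ENNReal.inv_eq_zero] at h1
    rcases h1 with h1 | h1
    · exact ENNReal.mul_ne_top haar_ball_ne_top enorm_ne_top h1
    · exact hpos.ne' h1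
  invariant := by
    intro Λ hΛ
    have hm := (continuous_radial hp t).measurable
    have ha := (continuous_act Λ).measurable
    have hcomm : act Λ ∘ radial t = radial t ∘ act Λ := by
      ext1 k
      simp only [Function.comp_apply, radial, radius, act_smul, Q_act hΛ]
    have hpre : act Λ ⁻¹' cone t = cone t := by
      ext k
      simp [cone, Q_act hΛ]
    have hmap : ((haarPi p 4).restrict (cone t)).map (act Λ) = (haarPi p 4).restrict (cone t) := by
      rw [← hpre, ← Measure.restrict_map ha (isOpen_cone t).measurableSet, hpre]
      congr 1
      exact map_mulVec_haarPi Λ (norm_det_of_mem_orthogonalGroup hΛ)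
    rw [leray, Measure.map_smul, Measure.map_map ha hm, hcomm, ← Measure.map_map hm ha, hmap]

/-- Scaling by x ∈ 1 + pℤ_p preserves Haar measure and the ray projection, and carries the shell
around radius 1 to the shell around radius x. -/
theorem haarPi_radial_preimage_smul_invariant (hp : p ≠ 2) {A : Set (Fin 4 → ℚ_[p])}
    (hA : MeasurableSet A) (r : ℝ) {x : ℚ_[p]} (hx : ‖x - 1‖ < 1) :
    haarPi p 4 (radial t ⁻¹' A ∩ cone t ∩ radius t ⁻¹' closedBall x r) =
      haarPi p 4 (radial t ⁻¹' A ∩ cone t ∩ radius t ⁻¹' closedBall 1 r) := by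
  have hx1 := norm_eq_one_of_norm_sub_one_lt hx
  have hpre : (fun k : Fin 4 → ℚ_[p] => x • k) ⁻¹'
      (radial t ⁻¹' A ∩ cone t ∩ radius t ⁻¹' closedBall x r) =
      radial t ⁻¹' A ∩ cone t ∩ radius t ⁻¹' closedBall 1 r := by
    ext k
    simp only [mem_preimage, mem_inter_iff, smul_mem_cone_iff hx, mem_closedBall, dist_eq_norm]
    by_cases hk : k ∈ cone t
    · have h : ‖x * radius t k - x‖ = ‖radius t k - 1‖ := by
        rw [← mul_sub_one, norm_mul, hx1, one_mul]
      rw [radial_smul hp hx hk, radius_smul hp hx hk, h]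
    · simp [hk]
  conv_lhs => rw [← map_smul_haarPi (n := 4) x hx1]
  rw [Measure.map_apply (measurable_const_smul x), hpre]
  exact (((continuous_radial hp t).measurable hA).inter (isOpen_cone t).measurableSet).inter
    ((continuous_radius hp t).measurable isClosed_closedBall.measurableSet)

/-- The Haar measures of the cone over `A` and of the thin shell in it are proportional. -/
theorem haar_ball_mul_haarPi_shell (hp : p ≠ 2) {A : Set (Fin 4 → ℚ_[p])}
    (hA : IsCompact A) {q : ℚ_[p]} (hq : q ≠ 0) (hq1 : ‖q‖ < 1) :
    haar p (ball 1 1) *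
      haarPi p 4 (radial t ⁻¹' A ∩ cone t ∩ radius t ⁻¹' closedBall 1 ‖q‖) =
    haarPi p 4 (radial t ⁻¹' A ∩ cone t) * ‖q‖ₑ := by
  have hAm := hA.isClosed.measurableSet
  have hm := (continuous_radius hp t).measurable
  have hS : MeasurableSet (radial t ⁻¹' A ∩ cone t) :=
    ((continuous_radial hp t).measurable hAm).inter (isOpen_cone t).measurableSet
  set M := (haarPi p 4).restrict (radial t ⁻¹' A ∩ cone t) with hM
  have hcb : ∀ x, MeasurableSet (closedBall x ‖q‖ : Set ℚ_[p]) :=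
    fun x => isClosed_closedBall.measurableSet
  have hνapply : ∀ x, M.map (radius t) (closedBall x ‖q‖) =
      haarPi p 4 (radial t ⁻¹' A ∩ cone t ∩ radius t ⁻¹' closedBall x ‖q‖) := by
    intro x
    rw [Measure.map_apply hm (hcb x), hM, Measure.restrict_apply (hm (hcb x)), inter_comm]
  -- The distribution of the radius over the cone on A gives equal mass to all balls of radius |q|
  -- centred in 1 + pℤ_p, as does Haar measure; so the two are proportional on such balls.
  have key := measure_univ_mul_eq_of_ae_measure_closedBall ((haar p).restrict (ball 1 1))
    (M.map (radius t)) (r := ‖q‖) (a := ‖q‖ₑ)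
    (b := haarPi p 4 (radial t ⁻¹' A ∩ cone t ∩ radius t ⁻¹' closedBall 1 ‖q‖)) ?_ ?_
  · rwa [Measure.restrict_apply_univ, Measure.map_apply hm MeasurableSet.univ, preimage_univ, hM,
      Measure.restrict_apply_univ] at key
  · have hae : ∀ᵐ x ∂(M.map (radius t)), x ∈ ball (1 : ℚ_[p]) 1 := by
      refine (ae_map_iff hm.aemeasurable (p := fun x => x ∈ ball (1 : ℚ_[p]) 1)
        isOpen_ball.measurableSet).2 ?_
      refine Filter.Eventually.of_forall fun k => ?_
      rw [mem_ball, dist_eq_norm]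
      exact norm_sqrtOne_sub_one_lt _
    filter_upwards [hae] with x hx
    rw [Measure.restrict_apply (hcb x), inter_eq_left.2, haar_closedBall x q hq]
    rw [IsUltrametricDist.ball_eq_of_mem hx]
    exact closedBall_subset_ball hq1
  · filter_upwards [ae_restrict_mem isOpen_ball.measurableSet] with x hx
    rw [hνapply]
    rw [mem_ball, dist_eq_norm] at hx
    exact haarPi_radial_preimage_smul_invariant hp hAm _ hx

theorem Q_single_one_sq (l : Fin 4) : Q (Pi.single l (1 : ℚ_[p]) : Fin 4 → ℚ_[p]) ^ 2 = 1 := by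
  fin_cases l <;> simp [Q, bilin]

theorem Q_insertNth (l : Fin 4) (a : ℚ_[p]) (z : Fin 3 → ℚ_[p]) :
    Q (l.insertNth a z : Fin 4 → ℚ_[p]) =
      Q (Pi.single l (1 : ℚ_[p]) : Fin 4 → ℚ_[p]) * a ^ 2 +
        Q (l.insertNth 0 z : Fin 4 → ℚ_[p]) := by
  have hd : bilin (Pi.single l 1) (l.insertNth 0 z : Fin 4 → ℚ_[p]) = 0 := by
    fin_cases l <;> simp [bilin]
  have hs : (l.insertNth a z : Fin 4 → ℚ_[p]) = a • Pi.single l 1 + l.insertNth 0 z := by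
    ext j
    induction j using l.succAboveCases <;> simp
  rw [hs]
  simp only [Q, bilin, Pi.add_apply, Pi.smul_apply, smul_eq_mul] at hd ⊢
  linear_combination 2 * a * hd

theorem norm_Q_insertNth_sub (l : Fin 4) (a b : ℚ_[p]) (z : Fin 3 → ℚ_[p]) :
    ‖Q (l.insertNth a z : Fin 4 → ℚ_[p]) - Q (l.insertNth b z : Fin 4 → ℚ_[p])‖ =
      ‖a ^ 2 - b ^ 2‖ := by
  have h1 : ‖Q (Pi.single l (1 : ℚ_[p]) : Fin 4 → ℚ_[p])‖ = 1 := by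
    rw [← pow_eq_one_iff_of_nonneg (norm_nonneg _) two_ne_zero, ← norm_pow, Q_single_one_sq,
      norm_one]
  rw [Q_insertNth l a, Q_insertNth l b, add_sub_add_right_eq_sub, ← mul_sub, norm_mul, h1, one_mul]

end Existence

/-! ### Thin shells as tubes, and the chart density of `leray` -/

section Existence

open Metric

variable {p : ℕ} [Fact p.Prime] {t : ℚ_[p]}

theorem IsCompact.exists_forall_norm_sub_lt {E F : Type*} [NormedAddCommGroup E]
    [NormedAddCommGroup F] {B : Set E} (hB : IsCompact B) (hBo : IsOpen B) {h : E → F}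
    (hh : ∀ y ∈ B, ContinuousAt h y) {ε : ℝ} (hε : 0 < ε) :
    ∃ δ > 0, ∀ y ∈ B, ∀ z, ‖z - y‖ < δ → z ∈ B ∧ ‖h z - h y‖ < ε := by
  obtain ⟨δ₁, hδ₁, h₁⟩ := hB.exists_thickening_subset_open hBo Subset.rfl
  obtain ⟨δ₂, hδ₂, h₂⟩ := Metric.mem_uniformity_dist.1
    (hB.uniformContinuousAt_of_continuousAt h hh (Metric.dist_mem_uniformity hε))
  refine ⟨min δ₁ δ₂, lt_min hδ₁ hδ₂, fun y hy z hz => ⟨h₁ ?_, ?_⟩⟩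
  · rw [mem_thickening_iff]
    exact ⟨y, hy, by rw [dist_eq_norm]; exact hz.trans_le (min_le_left _ _)⟩
  · have := h₂ (a := y) (b := z)
      (by rw [dist_comm, dist_eq_norm]; exact hz.trans_le (min_le_right _ _)) hy
    rwa [mem_ofPred_eq, dist_comm, dist_eq_norm] at this

theorem GraphChart.param_apply (c : GraphChart t) (y : Fin 3 → ℚ_[p]) :
    c.param y = c.l.insertNth (c.h y) y := rfl

theorem smul_insertNth (l : Fin 4) (u a : ℚ_[p]) (y : Fin 3 → ℚ_[p]) :
    u • (l.insertNth a y : Fin 4 → ℚ_[p]) = l.insertNth (u * a) (u • y) := by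
  ext j
  induction j using l.succAboveCases <;> simp

/-- A thin shell over a piece of a graph chart is a tube around the graph. -/
theorem GraphChart.shell_eq_tube (hp : p ≠ 2) (ht : t ≠ 0) (c : GraphChart t)
    {B : Set (Fin 3 → ℚ_[p])} (hBW : B ⊆ c.W) (hB : IsCompact B) (hBo : IsOpen B) :
    ∃ δ > 0, δ ≤ 1 ∧ ∀ q : ℚ_[p], ‖q‖ < δ → ∀ x z,
      ((c.l.insertNth x z : Fin 4 → ℚ_[p]) ∈
        radial t ⁻¹' (c.param '' B) ∩ cone t ∩ radius t ⁻¹' closedBall 1 ‖q‖ ↔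
        z ∈ B ∧ ‖x - c.h z‖ ≤ ‖q * t / c.h z‖) := by
  have hcont : ∀ y ∈ B, ContinuousAt c.h y := fun y hy => (c.analytic y (hBW hy)).continuousAt
  have htpos : 0 < ‖t‖ := norm_pos_iff.2 ht
  obtain ⟨ε, hε, hεB⟩ := hB.exists_forall_le' (f := fun y => ‖c.h y‖) (a := 0)
    (fun y hy => (hcont y hy).norm.continuousWithinAt)
    (fun y hy => norm_pos_iff.2 (c.h_ne_zero hp (hBW hy)))
  obtain ⟨δ₁, hδ₁, hδB⟩ := IsCompact.exists_forall_norm_sub_lt hB hBo hcont hε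
  obtain ⟨R, hR, hRB⟩ := hB.isBounded.exists_pos_norm_le
  -- The bound 1 keeps s in 1 + pℤ_p. The bound δ₁ / R makes scaling by s keep B stable and change h
  -- by less than ε ≤ |h|. The bound ε² / |t| makes the tube thinner than |h|, which singles out one
  -- of the two roots ±h.
  refine ⟨min 1 (min (δ₁ / R) (ε ^ 2 / ‖t‖)), by positivity, min_le_left _ _,
    fun q hq x z => ?_⟩
  have hq1 : ‖q‖ < 1 := hq.trans_le (min_le_left _ _)
  have hqR : ‖q‖ * R < δ₁ := by
    rw [← lt_div_iff₀ hR]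
    exact hq.trans_le ((min_le_right _ _).trans (min_le_left _ _))
  have hqt : ‖q‖ * ‖t‖ < ε ^ 2 := by
    rw [← lt_div_iff₀ htpos]
    exact hq.trans_le ((min_le_right _ _).trans (min_le_right _ _))
  have hstable : ∀ u : ℚ_[p], ‖u - 1‖ ≤ ‖q‖ → ∀ y ∈ B, u • y ∈ B ∧ ‖c.h (u • y) - c.h y‖ < ε := by
    intro u hu y hy
    apply hδB y hy
    rw [show u • y - y = (u - 1) • y by rw [sub_smul, one_smul], norm_smul]
    exact (mul_le_mul hu (hRB y hy) (norm_nonneg _) (norm_nonneg _)).trans_lt hqR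
  have hQV : ∀ y ∈ B, Q (c.l.insertNth (c.h y) y : Fin 4 → ℚ_[p]) = t :=
    fun y hy => c.mem_V y (hBW hy)
  simp only [mem_inter_iff, mem_preimage, mem_closedBall, dist_eq_norm]
  set k : Fin 4 → ℚ_[p] := c.l.insertNth x z with hk
  constructor
  · rintro ⟨⟨⟨y, hy, hyk⟩, hcone⟩, hu⟩
    have hkQ := Q_eq_of_mem_cone hp ht hcone
    have hrk := radius_smul_radial t k
    rw [← hyk, c.param_apply, smul_insertNth] at hrk
    set u := radius t k
    have hu1 : ‖u - 1‖ < 1 := hu.trans_lt hq1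
    obtain ⟨hx, hz⟩ := Fin.insertNth_injective2 (p := c.l) (α := fun _ => ℚ_[p]) hrk
    rw [← hz, ← hx]
    obtain ⟨huB, huh⟩ := hstable u hu y hy
    have hε1 := hεB _ huB
    have hheq : ‖c.h (u • y)‖ = ‖c.h y‖ := norm_eq_of_norm_sub_lt (huh.trans_le (hεB y hy))
    have hh0 : 0 < ‖c.h (u • y)‖ := hε.trans_le hε1
    have hnear : ‖u * c.h y - c.h (u • y)‖ < ‖c.h (u • y)‖ := by
      rw [show u * c.h y - c.h (u • y) = (u - 1) * c.h y + (c.h y - c.h (u • y)) by ring]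
      refine (IsUltrametricDist.norm_add_le_max _ _).trans_lt (max_lt ?_ ?_)
      · rw [norm_mul, hheq]
        exact mul_lt_of_lt_one_left (hheq ▸ hh0) hu1
      · rw [norm_sub_rev]
        exact huh.trans_le hε1
    refine ⟨huB, ?_⟩
    -- Both sides measure the same change of Q: it is |x - h| |h| along the l-th coordinate and |s -
    -- 1| |t| along the ray.
    have h1 := norm_Q_insertNth_sub c.l (u * c.h y) (c.h (u • y)) (u • y)
    rw [norm_sq_sub_sq hp hnear, hQV _ huB, hrk, hkQ,
      show u ^ 2 * t - t = (u ^ 2 - 1 ^ 2) * t by ring, norm_mul,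
      norm_sq_sub_sq_of_near_one hp hu1 (by simp)] at h1
    rw [norm_div, norm_mul, le_div_iff₀ hh0, ← h1]
    exact mul_le_mul_of_nonneg_right hu htpos.le
  · rintro ⟨hz, hx⟩
    have hε1 := hεB _ hz
    have hh0 : 0 < ‖c.h z‖ := hε.trans_le hε1
    rw [norm_div, norm_mul, le_div_iff₀ hh0] at hx
    have hnear : ‖x - c.h z‖ < ‖c.h z‖ := by
      by_contra hcon
      push Not at hcon
      nlinarith [norm_nonneg (x - c.h z)]
    have hkt : ‖Q k - t‖ ≤ ‖q‖ * ‖t‖ := by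
      have h1 := norm_Q_insertNth_sub c.l x (c.h z) z
      rw [norm_sq_sub_sq hp hnear, hQV _ hz, ← hk] at h1
      rwa [h1]
    have hkt' : ‖Q k / t - 1‖ ≤ ‖q‖ := by
      rwa [div_sub_one ht, norm_div, div_le_iff₀ htpos]
    have hcone : k ∈ cone t := hkt'.trans_lt hq1
    have hu : ‖radius t k - 1‖ ≤ ‖q‖ := by
      rwa [radius, norm_sqrtOne_sub_one hp hcone]
    refine ⟨⟨?_, hcone⟩, hu⟩
    have hV := radial_mem_V hp ht hcone
    have hu' : ‖(radius t k)⁻¹ - 1‖ ≤ ‖q‖ := by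
      rwa [norm_inv_sub_one (hu.trans_lt hq1)]
    change Q (radial t k) = t at hV
    rw [radial] at hV ⊢
    set w := (radius t k)⁻¹
    obtain ⟨hwB, hwh⟩ := hstable w hu' z hz
    refine ⟨w • z, hwB, ?_⟩
    rw [hk, smul_insertNth] at hV ⊢
    rw [c.param_apply]
    congr 1
    have hheq : ‖c.h (w • z)‖ = ‖c.h z‖ := norm_eq_of_norm_sub_lt (hwh.trans_le hε1)
    have hnear' : ‖w * x - c.h (w • z)‖ < ‖c.h (w • z)‖ := by
      rw [show w * x - c.h (w • z) = ((w - 1) * x + (x - c.h z)) + (c.h z - c.h (w • z)) by ring]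
      refine (IsUltrametricDist.norm_add_le_max _ _).trans_lt (max_lt
        ((IsUltrametricDist.norm_add_le_max _ _).trans_lt (max_lt ?_ ?_)) ?_)
      · rw [norm_mul, hheq, norm_eq_of_norm_sub_lt hnear]
        exact mul_lt_of_lt_one_left hh0 (hu'.trans_lt hq1)
      · rwa [hheq]
      · rw [norm_sub_rev, hheq]
        exact hwh.trans_le hε1
    -- The projected point and the graph point lie on V_t over the same base point and on the same
    -- branch, so their l-th coordinates agree.
    have h1 := norm_Q_insertNth_sub c.l (w * x) (c.h (w • z)) (w • z)
    rw [norm_sq_sub_sq hp hnear', hQV _ hwB, hV, sub_self, norm_zero, eq_comm, mul_eq_zero] at h1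
    rcases h1 with h1 | h1
    · rw [norm_eq_zero, sub_eq_zero] at h1
      exact h1.symm
    · rw [hheq] at h1
      exact absurd h1 hh0.ne'

theorem GraphChart.isCompact_image (c : GraphChart t)
    {B : Set (Fin 3 → ℚ_[p])} (hBW : B ⊆ c.W) (hB : IsCompact B) : IsCompact (c.param '' B) :=
  hB.image_of_continuousOn fun _ hy =>
    (c.hasFDerivAt_param (hBW hy)).continuousAt.continuousWithinAt

theorem exists_ne_zero_norm_lt {δ : ℝ} (hδ : 0 < δ) : ∃ q : ℚ_[p], q ≠ 0 ∧ ‖q‖ < δ := by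
  obtain ⟨q, h0, h⟩ := NormedField.exists_norm_lt ℚ_[p] hδ
  exact ⟨q, norm_pos_iff.1 h0, h⟩

theorem leray_image_param (hp : p ≠ 2) (ht : t ≠ 0) (c : GraphChart t)
    {B : Set (Fin 3 → ℚ_[p])} (hBW : B ⊆ c.W) (hB : IsCompact B) (hBo : IsOpen B) :
    leray t (c.param '' B) = ∫⁻ y in B, ‖c.h y‖ₑ⁻¹ ∂(haarPi p 3) := by
  obtain ⟨δ, hδ, hδ1, hshell⟩ := c.shell_eq_tube hp ht hBW hB hBo
  obtain ⟨q, hq, hqδ⟩ := exists_ne_zero_norm_lt (p := p) hδ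
  have hK := c.isCompact_image hBW hB
  have hAm := hK.isClosed.measurableSet
  have hTm : MeasurableSet (radial t ⁻¹' (c.param '' B) ∩ cone t ∩
      radius t ⁻¹' closedBall 1 ‖q‖) :=
    (((continuous_radial hp t).measurable hAm).inter (isOpen_cone t).measurableSet).inter
      ((continuous_radius hp t).measurable isClosed_closedBall.measurableSet)
  have hkey := haar_ball_mul_haarPi_shell (t := t) hp hK hq (hqδ.trans_le hδ1)
  have hshell_measure : haarPi p 4 (radial t ⁻¹' (c.param '' B) ∩ cone t ∩
      radius t ⁻¹' closedBall 1 ‖q‖) = ‖q‖ₑ * ‖t‖ₑ * ∫⁻ y in B, ‖c.h y‖ₑ⁻¹ ∂(haarPi p 3) := by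
    have hmp := (measurePreserving_piFinSuccAbove (fun _ : Fin 4 => haar p) c.l).symm
    have h1 := hmp.measure_preimage_equiv (radial t ⁻¹' (c.param '' B) ∩ cone t ∩
      radius t ⁻¹' closedBall 1 ‖q‖)
    rw [show haarPi p 4 = Measure.pi fun _ => haar p from rfl, ← h1,
      Measure.prod_apply_symm ((MeasurableEquiv.measurable _) hTm)]
    -- Slices of the tube in direction l are balls of radius |q t / h(z)|, and this radius is their
    -- Haar measure.
    have h2 : ∀ z : Fin 3 → ℚ_[p], haar p ((fun x => (x, z)) ⁻¹'
        ((MeasurableEquiv.piFinSuccAbove (fun _ : Fin 4 => ℚ_[p]) c.l).symm ⁻¹'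
          (radial t ⁻¹' (c.param '' B) ∩ cone t ∩ radius t ⁻¹' closedBall 1 ‖q‖))) =
        B.indicator (fun z => ‖q‖ₑ * ‖t‖ₑ * ‖c.h z‖ₑ⁻¹) z := by
      intro z
      have h3 : ∀ x, x ∈ (fun x => (x, z)) ⁻¹'
          ((MeasurableEquiv.piFinSuccAbove (fun _ : Fin 4 => ℚ_[p]) c.l).symm ⁻¹'
          (radial t ⁻¹' (c.param '' B) ∩ cone t ∩ radius t ⁻¹' closedBall 1 ‖q‖)) ↔
          z ∈ B ∧ ‖x - c.h z‖ ≤ ‖q * t / c.h z‖ := fun x => hshell q hqδ x z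
      by_cases hz : z ∈ B
      · have hh := c.h_ne_zero hp (hBW hz)
        have h4 : (fun x => (x, z)) ⁻¹'
          ((MeasurableEquiv.piFinSuccAbove (fun _ : Fin 4 => ℚ_[p]) c.l).symm ⁻¹'
          (radial t ⁻¹' (c.param '' B) ∩ cone t ∩ radius t ⁻¹' closedBall 1 ‖q‖)) =
          closedBall (c.h z) ‖q * t / c.h z‖ := by
          ext x
          rw [h3, mem_closedBall, dist_eq_norm]
          simp only [hz, true_and]
        have h0 : ‖c.h z‖₊ ≠ 0 := nnnorm_ne_zero_iff.2 hh
        rw [h4, indicator_of_mem hz, haar_closedBall _ _ (div_ne_zero (mul_ne_zero hq ht) hh)]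
        simp only [enorm_eq_nnnorm]
        rw [nnnorm_div, nnnorm_mul, div_eq_mul_inv, ENNReal.coe_mul, ENNReal.coe_mul,
          ENNReal.coe_inv h0]
      · rw [indicator_of_notMem hz]
        refine (congrArg (haar p) (eq_empty_of_forall_notMem fun x hx => ?_)).trans measure_empty
        exact hz ((h3 x).1 hx).1
    have h2' := lintegral_congr (μ := haarPi p 3) h2
    refine h2'.trans ?_
    rw [lintegral_indicator hBo.measurableSet, lintegral_const_mul']
    exact ENNReal.mul_ne_top enorm_ne_top enorm_ne_top
  rw [hshell_measure] at hkey
  have hq0 := enorm_ne_zero_of_ne_zero hq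
  have ht0 := enorm_ne_zero_of_ne_zero ht
  have hkey' : haarPi p 4 (radial t ⁻¹' (c.param '' B) ∩ cone t) =
      haar p (ball 1 1) * ‖t‖ₑ * ∫⁻ y in B, ‖c.h y‖ₑ⁻¹ ∂(haarPi p 3) := by
    rw [← ENNReal.mul_left_inj hq0 (enorm_ne_top (x := q)), ← hkey]
    ring
  rw [leray_apply hp hAm, hkey', ← mul_assoc, ENNReal.inv_mul_cancel, one_mul]
  · exact mul_ne_zero haar_ball_ne_zero ht0
  · exact ENNReal.mul_ne_top haar_ball_ne_top enorm_ne_top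

theorem isMeasureOfForm_leray (hp : p ≠ 2) (ht : t ≠ 0) :
    IsMeasureOfForm t (eulerForm t) (leray t) where
  supported := (isInvariantMeasure_leray hp ht).supported
  chart c B hBW hB hBo := by
    rw [leray_image_param hp ht c hBW hB hBo,
      (isGelfandLerayForm_eulerForm ht).lintegral_pullback hp c hBW hBo.measurableSet]

end Existence

/-! ### Graph charts cover V_t; uniqueness of λ_t -/

section Uniqueness

open Metric

variable {p : ℕ} [Fact p.Prime] {t : ℚ_[p]}

theorem analyticAt_Q_insertNth (l : Fin 4) (y : Fin 3 → ℚ_[p]) :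
    AnalyticAt ℚ_[p] (fun z : Fin 3 → ℚ_[p] => Q (l.insertNth 0 z : Fin 4 → ℚ_[p])) y := by
  have h : ∀ j : Fin 4, AnalyticAt ℚ_[p]
      (fun z : Fin 3 → ℚ_[p] => (l.insertNth 0 z : Fin 4 → ℚ_[p]) j) y := by
    intro j
    induction j using l.succAboveCases with
    | x => simpa using analyticAt_const
    | p i =>
      simp only [Fin.insertNth_apply_succAbove]
      exact (ContinuousLinearMap.proj (R := ℚ_[p]) (φ := fun _ : Fin 3 => ℚ_[p]) i).analyticAt y
  exact ((((h 0).mul (h 0)).sub ((h 1).mul (h 1))).sub ((h 2).mul (h 2))).sub ((h 3).mul (h 3))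

theorem norm_div_sub_one_lt {x a : ℚ_[p]} (ha : a ≠ 0) (h : ‖x - a‖ < ‖a‖) :
    ‖x / a - 1‖ < 1 := by
  rwa [div_sub_one ha, norm_div, div_lt_one (norm_pos_iff.2 ha)]

/-- Around each of its points `V_t` is the image of a graph chart. -/
theorem exists_graphChart (hp : p ≠ 2) (ht : t ≠ 0) {k : Fin 4 → ℚ_[p]} (hk : k ∈ V t) :
    ∃ c : GraphChart t, ∃ r > 0, V t ∩ closedBall k r ⊆ c.param '' c.W := by
  obtain ⟨l, hl⟩ : ∃ l, k l ≠ 0 := by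
    by_contra! hcon
    apply ht
    rw [← show Q k = t from hk]
    simp [Q, bilin, hcon]
  set a := k l with ha
  have ha2 : a ^ 2 ≠ 0 := pow_ne_zero 2 hl
  set s : ℚ_[p] := Q (Pi.single l (1 : ℚ_[p]) : Fin 4 → ℚ_[p]) with hs
  have hs2 : s ^ 2 = 1 := Q_single_one_sq l
  -- Since s = ±1, the equation Q = t for the l-th coordinate x reads (x / a)² = g(y). As g = 1 at
  -- the centre, it is solved nearby by x = a √g.
  let g : (Fin 3 → ℚ_[p]) → ℚ_[p] :=
    fun y => s * (t - Q (l.insertNth 0 y : Fin 4 → ℚ_[p])) / a ^ 2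
  have hg : ∀ y, AnalyticAt ℚ_[p] g y := fun y =>
    (analyticAt_const.mul (analyticAt_const.sub (analyticAt_Q_insertNth l y))).div analyticAt_const
      ha2
  have hVg : ∀ x y, Q (l.insertNth x y : Fin 4 → ℚ_[p]) = t ↔ (x / a) ^ 2 = g y := by
    intro x y
    rw [Q_insertNth, ← hs]
    simp only [g]
    rw [div_pow, div_left_inj' ha2]
    constructor
    · intro h
      linear_combination (-x ^ 2) * hs2 + s * h
    · intro h
      linear_combination s * h + (t - Q (l.insertNth 0 y : Fin 4 → ℚ_[p])) * hs2
  have hk1 : g (l.removeNth k) = 1 := by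
    rw [← (hVg a (l.removeNth k)).1 (by rw [ha, Fin.insertNth_self_removeNth]; exact hk),
      div_self hl, one_pow]
  obtain ⟨r₁, hr₁, hr₁g⟩ : ∃ r > 0, ∀ y ∈ closedBall (l.removeNth k) r, ‖g y - 1‖ < 1 := by
    have hev : ∀ᶠ y in nhds (l.removeNth k), ‖g y - 1‖ < 1 := by
      refine ((hg _).continuousAt.sub continuousAt_const).norm.eventually_lt continuousAt_const ?_
      simp [hk1]
    exact Metric.nhds_basis_closedBall.eventually_iff.1 hev
  have hapos : 0 < ‖a‖ := norm_pos_iff.2 hl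
  let c : GraphChart t :=
    { l := l
      W := closedBall (l.removeNth k) r₁
      h := fun y => a * sqrtOne (g y)
      isCompact_W := isCompact_closedBall _ _
      isOpen_W := IsUltrametricDist.isOpen_closedBall _ hr₁.ne'
      analytic := fun y hy => analyticAt_const.mul
        ((analyticAt_sqrtOne hp (hr₁g y hy)).comp (hg y))
      mem_V := fun y hy => by
        change Q _ = t
        rw [hVg, mul_div_cancel_left₀ _ hl, sqrtOne_sq hp (hr₁g y hy)]
      partial_ne_zero := fun y hy => by
        rw [← norm_pos_iff, norm_fderiv_Q_single hp, Fin.insertNth_apply_same, norm_pos_iff]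
        exact mul_ne_zero hl (sqrtOne_ne_zero _) }
  -- The bound |a| / 2 forces |x - a| < |a|, which excludes the other root x = -a √g.
  refine ⟨c, min r₁ (‖a‖ / 2), lt_min hr₁ (by positivity), ?_⟩
  rintro k' ⟨hk', hball⟩
  rw [mem_closedBall, dist_eq_norm] at hball
  have hy : l.removeNth k' ∈ closedBall (l.removeNth k) r₁ := by
    rw [mem_closedBall, dist_pi_le_iff hr₁.le]
    intro i
    exact (norm_le_pi_norm (k' - k) (l.succAbove i)).trans (hball.trans (min_le_left _ _))
  refine ⟨l.removeNth k', hy, ?_⟩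
  have hx : ‖k' l - a‖ < ‖a‖ := by
    refine ((norm_le_pi_norm (k' - k) l).trans (hball.trans (min_le_right _ _))).trans_lt ?_
    linarith
  have h1 := (hVg (k' l) (l.removeNth k')).1 (by rw [Fin.insertNth_self_removeNth]; exact hk')
  have h2 : sqrtOne (g (l.removeNth k')) = k' l / a := by
    rw [← h1, sqrtOne_sq_self hp (norm_div_sub_one_lt hl hx)]
  change l.insertNth (a * sqrtOne (g (l.removeNth k'))) (l.removeNth k') = k'
  rw [h2, mul_div_cancel₀ _ hl, Fin.insertNth_self_removeNth]

theorem measure_inter_V {μ : Measure (Fin 4 → ℚ_[p])} (hμ : μ (V t)ᶜ = 0)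
    (S : Set (Fin 4 → ℚ_[p])) : μ (V t ∩ S) = μ S := by
  rw [inter_comm]
  exact measure_inter_conull hμ

theorem restrict_compl_V_eq {μ ν : Measure (Fin 4 → ℚ_[p])} (hμ : μ (V t)ᶜ = 0)
    (hν : ν (V t)ᶜ = 0) : μ.restrict (V t)ᶜ = ν.restrict (V t)ᶜ := by
  rw [Measure.restrict_eq_zero.2 hμ, Measure.restrict_eq_zero.2 hν]

/-- Near a point of V_t, each small ball cuts out the image of an open compact piece of one chart,
where both measures integrate 1/|h|. -/
theorem IsGelfandLerayMeasure.eq_leray (hp : p ≠ 2) (ht : t ≠ 0)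
    {lam : Measure (Fin 4 → ℚ_[p])} (hlam : IsGelfandLerayMeasure t lam) : lam = leray t := by
  obtain ⟨ω, hω, hsupp, hchart⟩ := hlam
  have hinv := isInvariantMeasure_leray hp ht
  refine (measure_ext_of_locally_eq fun k => ?_).symm
  by_cases hk : k ∈ V t
  swap
  · exact ⟨_, (isClosed_V t).isOpen_compl.mem_nhds hk, restrict_compl_V_eq hinv.supported hsupp⟩
  obtain ⟨c, r₀, hr₀, hc⟩ := exists_graphChart hp ht hk
  refine ⟨_, closedBall_mem_nhds k hr₀, restrict_closedBall_eq_of_forall_closedBall_eq hr₀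
    (hinv.finite_on_compacts _ (isCompact_closedBall _ _)).ne fun z hz r hr hrr => ?_⟩
  rw [← measure_inter_V hinv.supported, ← measure_inter_V hsupp]
  have hcont : ContinuousOn c.param c.W := fun y hy =>
    (c.hasFDerivAt_param hy).continuousAt.continuousWithinAt
  have hBo : IsOpen (c.W ∩ c.param ⁻¹' closedBall z r) :=
    hcont.isOpen_inter_preimage c.isOpen_W (IsUltrametricDist.isOpen_closedBall _ hr.ne')
  have hBc : IsCompact (c.W ∩ c.param ⁻¹' closedBall z r) :=
    c.isCompact_W.of_isClosed_subset
      (hcont.preimage_isClosed_of_isClosed c.isCompact_W.isClosed isClosed_closedBall)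
      inter_subset_left
  have himage : V t ∩ closedBall z r = c.param '' (c.W ∩ c.param ⁻¹' closedBall z r) := by
    ext x
    constructor
    · rintro ⟨hx, hxz⟩
      have hxk : x ∈ closedBall k r₀ := by
        rw [IsUltrametricDist.closedBall_eq_of_mem hz]
        exact closedBall_subset_closedBall hrr hxz
      obtain ⟨y, hy, rfl⟩ := hc ⟨hx, hxk⟩
      exact ⟨y, ⟨hy, hxz⟩, rfl⟩
    · rintro ⟨y, ⟨hy, hyz⟩, rfl⟩
      exact ⟨c.mem_V y hy, hyz⟩
  rw [himage, hchart c _ inter_subset_left hBc hBo, leray_image_param hp ht c inter_subset_left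
    hBc hBo, hω.lintegral_pullback hp c inter_subset_left hBo.measurableSet]

/-! ### Reflections and the action of O(Q) on V_t -/

/-- The covector `[v, ·]`. -/
noncomputable def covector (v : Fin 4 → ℚ_[p]) : Fin 4 → ℚ_[p] := ![v 0, -v 1, -v 2, -v 3]

theorem covector_dotProduct (v z : Fin 4 → ℚ_[p]) : covector v ⬝ᵥ z = bilin z v := by
  simp [covector, bilin, dotProduct, Fin.sum_univ_four]
  ring

/-- The matrix of the reflection `z ↦ z - 2 [z, v] / [v, v] v`. -/
noncomputable def reflectionMatrix (v : Fin 4 → ℚ_[p]) : Matrix (Fin 4) (Fin 4) ℚ_[p] :=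
  1 - (2 / Q v) • Matrix.vecMulVec v (covector v)

theorem reflectionMatrix_mul_self {v : Fin 4 → ℚ_[p]} (hv : Q v ≠ 0) :
    reflectionMatrix v * reflectionMatrix v = 1 := by
  have h : Matrix.vecMulVec v (covector v) * Matrix.vecMulVec v (covector v) =
      Q v • Matrix.vecMulVec v (covector v) := by
    rw [Matrix.vecMulVec_mul_vecMulVec, covector_dotProduct]
    ext i j
    simp [Matrix.vecMulVec_apply, Q]
    ring
  rw [reflectionMatrix, mul_sub, sub_mul, sub_mul, mul_one, mul_one, one_mul, smul_mul_smul_comm,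
    h, smul_smul, show 2 / Q v * (2 / Q v) * Q v = 2 / Q v + 2 / Q v by field_simp; norm_num,
    add_smul]
  abel

/-- The reflection in an anisotropic vector. -/
noncomputable def reflection (v : Fin 4 → ℚ_[p]) (hv : Q v ≠ 0) : GL (Fin 4) ℚ_[p] :=
  ⟨reflectionMatrix v, reflectionMatrix v, reflectionMatrix_mul_self hv,
    reflectionMatrix_mul_self hv⟩

theorem act_reflection {v : Fin 4 → ℚ_[p]} (hv : Q v ≠ 0) (z : Fin 4 → ℚ_[p]) :
    act (reflection v hv) z = z - (2 * bilin z v / Q v) • v := by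
  change (reflectionMatrix v).mulVec z = _
  rw [reflectionMatrix, Matrix.sub_mulVec, Matrix.one_mulVec, Matrix.smul_mulVec,
    Matrix.vecMulVec_mulVec, covector_dotProduct]
  ext i
  simp
  ring

theorem bilin_sub_smul (x y v : Fin 4 → ℚ_[p]) (a b : ℚ_[p]) :
    bilin (x - a • v) (y - b • v) = bilin x y - b * bilin x v - a * bilin y v + a * b * Q v := by
  simp only [Q, bilin, Pi.sub_apply, Pi.smul_apply, smul_eq_mul]
  ring

theorem reflection_mem {v : Fin 4 → ℚ_[p]} (hv : Q v ≠ 0) :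
    reflection v hv ∈ orthogonalGroup p := by
  intro x y
  rw [act_reflection, act_reflection, bilin_sub_smul]
  field_simp
  ring

theorem act_mul (a b : GL (Fin 4) ℚ_[p]) (z : Fin 4 → ℚ_[p]) : act (a * b) z = act a (act b z) := by
  simp [act, Matrix.mulVec_mulVec]

theorem act_neg (a : GL (Fin 4) ℚ_[p]) (z : Fin 4 → ℚ_[p]) : act a (-z) = -act a z :=
  Matrix.mulVec_neg _ _

theorem act_reflection_sub {x y : Fin 4 → ℚ_[p]} (hxy : Q x = Q y) (hv : Q (x - y) ≠ 0) :
    act (reflection (x - y) hv) x = y := by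
  have h : 2 * bilin x (x - y) = Q (x - y) := by
    simp only [Q, bilin, Pi.sub_apply] at hxy ⊢
    linear_combination hxy
  rw [act_reflection, h, div_self hv, one_smul, sub_sub_cancel]

theorem act_reflection_add {x y : Fin 4 → ℚ_[p]} (hxy : Q x = Q y) (hv : Q (x + y) ≠ 0) :
    act (reflection (x + y) hv) x = -y := by
  have h : 2 * bilin x (x + y) = Q (x + y) := by
    simp only [Q, bilin, Pi.add_apply] at hxy ⊢
    linear_combination hxy
  rw [act_reflection, h, div_self hv, one_smul, sub_add_cancel_left]

theorem act_reflection_self {x : Fin 4 → ℚ_[p]} (hx : Q x ≠ 0) : act (reflection x hx) x = -x := by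
  rw [act_reflection, mul_div_assoc, show bilin x x = Q x from rfl, div_self hx, mul_one, two_smul]
  abel

/-- `O(Q)` acts transitively on `V_t`. -/
theorem exists_act_eq (ht : t ≠ 0) {x y : Fin 4 → ℚ_[p]} (hx : x ∈ V t) (hy : y ∈ V t) :
    ∃ Λ ∈ orthogonalGroup p, act Λ x = y := by
  have hx' : Q x = t := hx
  have hy' : Q y = t := hy
  -- Since Q(x - y) + Q(x + y) = 4t ≠ 0, one of x - y and x + y is anisotropic. Reflecting in x - y
  -- sends x to y; reflecting in x + y sends x to -y, which the reflection in y corrects.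
  by_cases h : Q (x - y) = 0
  · have h4 : Q (x + y) ≠ 0 := by
      have h5 : Q (x + y) = 2 * Q x + 2 * Q y - Q (x - y) := by
        simp only [Q, bilin, Pi.add_apply, Pi.sub_apply]
        ring
      rw [h5, h, hx', hy', sub_zero, ← two_mul]
      exact mul_ne_zero two_ne_zero (mul_ne_zero two_ne_zero ht)
    have hy0 : Q y ≠ 0 := by rwa [hy']
    refine ⟨reflection y hy0 * reflection (x + y) h4,
      mul_mem (reflection_mem _) (reflection_mem _), ?_⟩
    rw [act_mul, act_reflection_add (hx'.trans hy'.symm), act_neg, act_reflection_self, neg_neg]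
  · exact ⟨_, reflection_mem h, act_reflection_sub (hx'.trans hy'.symm) h⟩

/-- The ultrametric inequality gives |(A - 1) z| < |z|, so A z and z have the same norm. -/
theorem norm_mulVec_eq_of_norm_sub_one_lt {A : Matrix (Fin 4) (Fin 4) ℚ_[p]}
    (hA : ∀ i j, ‖(A - 1) i j‖ < 1) (z : Fin 4 → ℚ_[p]) : ‖A.mulVec z‖ = ‖z‖ := by
  by_cases hz : z = 0
  · simp [hz]
  have hz0 : 0 < ‖z‖ := norm_pos_iff.2 hz
  apply norm_eq_of_norm_sub_lt
  rw [show A.mulVec z - z = (A - 1).mulVec z by rw [Matrix.sub_mulVec, Matrix.one_mulVec],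
    pi_norm_lt_iff hz0]
  intro i
  obtain ⟨j, -, hj⟩ := IsUltrametricDist.exists_norm_finsetSum_le_of_nonempty
    (Finset.univ_nonempty (α := Fin 4)) (fun j => (A - 1) i j * z j)
  refine hj.trans_lt ?_
  rw [norm_mul]
  calc ‖(A - 1) i j‖ * ‖z j‖ ≤ ‖(A - 1) i j‖ * ‖z‖ :=
        mul_le_mul_of_nonneg_left (norm_le_pi_norm z j) (norm_nonneg _)
    _ < ‖z‖ := mul_lt_of_lt_one_left hz0 (hA i j)

theorem continuousAt_reflectionMatrix {v : Fin 4 → ℚ_[p]} (hv : Q v ≠ 0) :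
    ContinuousAt reflectionMatrix v := by
  unfold reflectionMatrix
  refine continuousAt_const.sub ((continuousAt_const.div continuous_Q.continuousAt hv).smul ?_)
  refine (Continuous.matrix_vecMulVec continuous_id ?_).continuousAt
  refine continuous_pi fun i => ?_
  fin_cases i <;> simp [covector] <;> fun_prop

/-- Points of `V_t` near `x₀` are images of `x₀` under isometries in `O(Q)`. -/
theorem exists_isometry_act_eq (ht : t ≠ 0) {x₀ : Fin 4 → ℚ_[p]} (hx₀ : x₀ ∈ V t) :
    ∃ r > 0, ∀ x ∈ V t ∩ closedBall x₀ r,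
      ∃ Λ ∈ orthogonalGroup p, act Λ x₀ = x ∧ ∀ z, ‖act Λ z‖ = ‖z‖ := by
  have hQ0 : Q x₀ = t := hx₀
  have h0 : Q x₀ ≠ 0 := by rwa [hQ0]
  have h2 : Q (x₀ + x₀) ≠ 0 := by
    rw [← two_smul ℚ_[p], Q_smul]
    exact mul_ne_zero (pow_ne_zero 2 two_ne_zero) h0
  -- The product of the reflections in x₀ and then x₀ + x sends x₀ to -x₀ and then to x. It is the
  -- identity at x = x₀, so by continuity its entries stay within distance less than 1 of those of
  -- the identity, making it an isometry.
  have hc : ContinuousAt (fun x => reflectionMatrix (x₀ + x) * reflectionMatrix x₀ - 1) x₀ := by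
    refine ContinuousAt.sub (ContinuousAt.mul ?_ continuousAt_const) continuousAt_const
    exact ContinuousAt.comp (f := fun x => x₀ + x) (continuousAt_reflectionMatrix h2)
      (continuous_const.add continuous_id).continuousAt
  have hval : reflectionMatrix (x₀ + x₀) * reflectionMatrix x₀ - 1 = 0 := by
    have : reflectionMatrix (x₀ + x₀) = reflectionMatrix x₀ := by
      rw [← two_smul ℚ_[p], reflectionMatrix, reflectionMatrix, Q_smul]
      congr 1
      ext i j
      fin_cases j <;> simp [covector] <;> field_simp
    rw [this, reflectionMatrix_mul_self h0, sub_self]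
  have hev : ∀ᶠ x in nhds x₀, (∀ i j,
      ‖(reflectionMatrix (x₀ + x) * reflectionMatrix x₀ - 1) i j‖ < 1) ∧ Q (x₀ + x) ≠ 0 := by
    refine Filter.Eventually.and ?_ ?_
    · rw [Filter.eventually_all]
      intro i
      rw [Filter.eventually_all]
      intro j
      have hij : ContinuousAt
          (fun x => (reflectionMatrix (x₀ + x) * reflectionMatrix x₀ - 1) i j) x₀ :=
        continuousAt_pi.1 (continuousAt_pi.1 hc i) j
      refine hij.norm.eventually_lt continuousAt_const ?_
      rw [hval]
      simp
    · exact (continuous_Q.comp (continuous_const.add continuous_id)).continuousAt.eventually_ne h2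
  obtain ⟨r, hr, hball⟩ := Metric.nhds_basis_closedBall.eventually_iff.1 hev
  refine ⟨r, hr, ?_⟩
  rintro x ⟨hx, hxr⟩
  obtain ⟨hA, hQ⟩ := hball hxr
  refine ⟨reflection (x₀ + x) hQ * reflection x₀ h0,
    mul_mem (reflection_mem _) (reflection_mem _), ?_, fun z => ?_⟩
  · rw [act_mul, act_reflection_self, act_neg, act_reflection_add (hQ0.trans (Eq.symm hx)), neg_neg]
  · exact norm_mulVec_eq_of_norm_sub_one_lt hA z

/-! ### Uniqueness of invariant measures -/

theorem measure_closedBall_eq_of_isometry {μ : Measure (Fin 4 → ℚ_[p])}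
    {Λ : GL (Fin 4) ℚ_[p]} (hμ : μ.map (act Λ) = μ) (hΛ : ∀ z, ‖act Λ z‖ = ‖z‖)
    (x : Fin 4 → ℚ_[p]) (r : ℝ) : μ (closedBall (act Λ x) r) = μ (closedBall x r) := by
  conv_lhs => rw [← hμ]
  rw [Measure.map_apply (continuous_act Λ).measurable isClosed_closedBall.measurableSet]
  congr 1
  ext z
  rw [mem_preimage, mem_closedBall, mem_closedBall, dist_eq_norm, dist_eq_norm, ← hΛ (z - x)]
  rw [show act Λ (z - x) = act Λ z - act Λ x from Matrix.mulVec_sub _ _ _]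

/-- Invariant measures on `V_t` which agree near one point are equal. -/
theorem eq_of_restrict_eq_of_invariant (ht : t ≠ 0) {μ ν : Measure (Fin 4 → ℚ_[p])}
    (hμV : μ (V t)ᶜ = 0) (hνV : ν (V t)ᶜ = 0)
    (hμ : ∀ Λ ∈ orthogonalGroup p, μ.map (act Λ) = μ)
    (hν : ∀ Λ ∈ orthogonalGroup p, ν.map (act Λ) = ν)
    {x₀ : Fin 4 → ℚ_[p]} (hx₀ : x₀ ∈ V t) {r : ℝ} (hr : 0 < r)
    (h : μ.restrict (closedBall x₀ r) = ν.restrict (closedBall x₀ r)) : μ = ν := by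
  refine measure_ext_of_locally_eq fun x => ?_
  by_cases hx : x ∈ V t
  swap
  · exact ⟨_, (isClosed_V t).isOpen_compl.mem_nhds hx, restrict_compl_V_eq hμV hνV⟩
  obtain ⟨Λ, hΛ, rfl⟩ := exists_act_eq ht hx₀ hx
  have hinv : ∀ z, act Λ⁻¹ (act Λ z) = z := by
    intro z
    rw [← act_mul, inv_mul_cancel]
    simp [act]
  have hpre : act Λ ⁻¹' (act Λ⁻¹ ⁻¹' closedBall x₀ r) = closedBall x₀ r := by
    ext z
    simp only [mem_preimage, hinv]
  have hmeas : MeasurableSet (act Λ⁻¹ ⁻¹' closedBall x₀ r) :=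
    (continuous_act Λ⁻¹).measurable isClosed_closedBall.measurableSet
  refine ⟨act Λ⁻¹ ⁻¹' closedBall x₀ r, ?_, ?_⟩
  · refine (continuous_act Λ⁻¹).continuousAt.preimage_mem_nhds ?_
    rw [hinv]
    exact closedBall_mem_nhds x₀ hr
  · rw [← hμ Λ hΛ, ← hν Λ hΛ, Measure.restrict_map (continuous_act Λ).measurable hmeas,
      Measure.restrict_map (continuous_act Λ).measurable hmeas, hpre, h]

theorem sigmaFinite_of_finite_on_compacts {μ : Measure (Fin 4 → ℚ_[p])}
    (hμ : ∀ K, IsCompact K → μ K < ∞) : SigmaFinite μ :=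
  have : IsFiniteMeasureOnCompacts μ := ⟨fun {K} => hμ K⟩
  inferInstance

/-- `O(Q)`-invariant measures on `V_t` are unique up to a positive constant. -/
theorem IsInvariantMeasure.exists_eq_smul (ht : t ≠ 0) {μ ν : Measure (Fin 4 → ℚ_[p])}
    (hμ : IsInvariantMeasure t μ) (hν : IsInvariantMeasure t ν) :
    ∃ A : ℝ≥0, 0 < A ∧ μ = A • ν := by
  obtain ⟨x₀, hx₀⟩ := exists_Q_eq t
  obtain ⟨r₀, hr₀, hiso⟩ := exists_isometry_act_eq ht hx₀
  set B := closedBall x₀ r₀ with hB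
  have hBm : MeasurableSet B := isClosed_closedBall.measurableSet
  have := sigmaFinite_of_finite_on_compacts hμ.finite_on_compacts
  have := sigmaFinite_of_finite_on_compacts hν.finite_on_compacts
  have hfin : ∀ {ρ : Measure (Fin 4 → ℚ_[p])}, IsInvariantMeasure t ρ → ρ B ≠ ∞ :=
    fun hρ => (hρ.finite_on_compacts B (isCompact_closedBall _ _)).ne
  have hpos : ∀ {ρ : Measure (Fin 4 → ℚ_[p])}, IsInvariantMeasure t ρ → ρ B ≠ 0 := by
    intro ρ hρ h
    -- The zero measure is invariant too, so an invariant measure vanishing on B equals it.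
    refine hρ.ne_zero (eq_of_restrict_eq_of_invariant (ν := 0) ht hρ.supported (by simp)
      hρ.invariant (by simp) hx₀ hr₀ ?_)
    rw [Measure.restrict_eq_zero.2 h, Measure.restrict_zero]
  have hball : ∀ {ρ : Measure (Fin 4 → ℚ_[p])}, IsInvariantMeasure t ρ → ∀ x ∈ V t ∩ B, ∀ r,
      ρ (closedBall x r) = ρ (closedBall x₀ r) := by
    intro ρ hρ x hx r
    obtain ⟨Λ, hΛ, rfl, hn⟩ := hiso x hx
    exact measure_closedBall_eq_of_isometry (hρ.invariant Λ hΛ) hn x₀ r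
  have hsub : ∀ x ∈ B, ∀ r ≤ r₀, closedBall x r ⊆ B := by
    intro x hx r hr
    rw [hB, IsUltrametricDist.closedBall_eq_of_mem hx]
    exact closedBall_subset_closedBall hr
  have hae : ∀ {ρ : Measure (Fin 4 → ℚ_[p])}, IsInvariantMeasure t ρ →
      ∀ᵐ x ∂(ρ.restrict B), x ∈ V t ∩ B := by
    intro ρ hρ
    have h1 : ∀ᵐ x ∂ρ, x ∈ V t := hρ.supported
    filter_upwards [ae_restrict_mem hBm, ae_restrict_of_ae h1] with x hx hxV
    exact ⟨hxV, hx⟩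
  have hprop : ∀ r ≤ r₀, μ B * ν (closedBall x₀ r) = ν B * μ (closedBall x₀ r) := by
    intro r hr
    have key := measure_univ_mul_eq_of_ae_measure_closedBall (μ.restrict B) (ν.restrict B) (r := r)
      (a := μ (closedBall x₀ r)) (b := ν (closedBall x₀ r)) ?_ ?_
    · rwa [Measure.restrict_apply_univ, Measure.restrict_apply_univ] at key
    · filter_upwards [hae hν] with x hx
      rw [Measure.restrict_apply isClosed_closedBall.measurableSet,
        inter_eq_left.2 (hsub x hx.2 r hr), hball hμ x hx]
    · filter_upwards [hae hμ] with x hx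
      rw [Measure.restrict_apply isClosed_closedBall.measurableSet,
        inter_eq_left.2 (hsub x hx.2 r hr), hball hν x hx]
  -- A small ball meeting V_t can be recentred at a point of V_t, where `hprop` applies; one missing
  -- V_t is null for both measures.
  have heq : ν B • μ = μ B • ν := by
    refine eq_of_restrict_eq_of_invariant ht (by simp [hμ.supported]) (by simp [hν.supported])
      (fun Λ hΛ => by rw [Measure.map_smul, hμ.invariant Λ hΛ])
      (fun Λ hΛ => by rw [Measure.map_smul, hν.invariant Λ hΛ]) hx₀ hr₀ ?_
    refine restrict_closedBall_eq_of_forall_closedBall_eq hr₀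
      (ENNReal.mul_ne_top (hfin hν) (hfin hμ)) fun z hz r hr hrr => ?_
    simp only [Measure.smul_apply, smul_eq_mul]
    by_cases hne : (V t ∩ closedBall z r).Nonempty
    · obtain ⟨x, hxV, hxz⟩ := hne
      rw [IsUltrametricDist.closedBall_eq_of_mem hxz, hball hμ x ⟨hxV, hsub z hz r hrr hxz⟩,
        hball hν x ⟨hxV, hsub z hz r hrr hxz⟩, hprop r hrr]
    · rw [not_nonempty_iff_eq_empty] at hne
      rw [← measure_inter_V hμ.supported, ← measure_inter_V hν.supported (closedBall z r), hne,
        measure_empty, measure_empty, mul_zero, mul_zero]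
  have hA0 : μ B / ν B ≠ 0 := ENNReal.div_ne_zero.2 ⟨hpos hμ, hfin hν⟩
  have hA1 : μ B / ν B ≠ ∞ := ENNReal.div_ne_top (hfin hμ) (hpos hν)
  refine ⟨(μ B / ν B).toNNReal, ENNReal.toNNReal_pos hA0 hA1, ?_⟩
  ext s hs
  have h1 := congrArg (fun ρ : Measure (Fin 4 → ℚ_[p]) => ρ s) heq
  simp only [Measure.smul_apply, smul_eq_mul] at h1
  rw [Measure.smul_apply, ENNReal.smul_def, smul_eq_mul, ENNReal.coe_toNNReal hA1,
    ← ENNReal.mul_right_inj (hpos hν) (hfin hν), h1, ← mul_assoc,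
    ENNReal.mul_div_cancel (hpos hν) (hfin hν)]

theorem integrable_of_isTestFunction {μ : Measure (Fin 4 → ℚ_[p])} (hμ : IsInvariantMeasure t μ)
    {φ : (Fin 4 → ℚ_[p]) → ℂ} (hφ : IsTestFunction φ) : Integrable φ μ :=
  have : IsFiniteMeasureOnCompacts μ := ⟨fun {K} => hμ.finite_on_compacts K⟩
  hφ.1.continuous.integrable_of_hasCompactSupport hφ.2

theorem integral_act_eq {μ : Measure (Fin 4 → ℚ_[p])} (hμ : IsInvariantMeasure t μ)
    {φ : (Fin 4 → ℚ_[p]) → ℂ} (hφ : IsTestFunction φ) {Λ : GL (Fin 4) ℚ_[p]}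
    (hΛ : Λ ∈ orthogonalGroup p) : ∫ k, φ (act Λ k) ∂μ = ∫ k, φ k ∂μ := by
  conv_rhs => rw [← hμ.invariant Λ hΛ]
  rw [integral_map (continuous_act Λ).measurable.aemeasurable
    hφ.1.continuous.aestronglyMeasurable]

end Uniqueness

end PAdicMinkowski

theorem lemma1 (p : ℕ) [Fact p.Prime] (hp : p ≠ 2) (t : ℚ_[p]) (ht : t ≠ 0) :
    ∃ lam : Measure (Fin 4 → ℚ_[p]),
      -- `lam` is the Gel'fand-Leray measure, which exists and is unique
      PAdicMinkowski.IsGelfandLerayMeasure t lam ∧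
      (∀ lam' : Measure (Fin 4 → ℚ_[p]),
        PAdicMinkowski.IsGelfandLerayMeasure t lam' → lam' = lam) ∧
      -- it is an invariant measure on `V_t`
      PAdicMinkowski.IsInvariantMeasure t lam ∧
      -- the distribution `φ ↦ ∫ φ dlam` is well defined and invariant
      (∀ φ : (Fin 4 → ℚ_[p]) → ℂ, PAdicMinkowski.IsTestFunction φ →
        Integrable φ lam ∧
        ∀ Λ ∈ PAdicMinkowski.orthogonalGroup p,
          ∫ k, φ (PAdicMinkowski.act Λ k) ∂lam = ∫ k, φ k ∂lam) ∧
      -- every invariant measure on `V_t` is a positive multiple of it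
      (∀ μ : Measure (Fin 4 → ℚ_[p]), PAdicMinkowski.IsInvariantMeasure t μ →
        ∃ A : ℝ≥0, 0 < A ∧ μ = A • lam) := by
  have hinv := PAdicMinkowski.isInvariantMeasure_leray hp ht
  exact ⟨PAdicMinkowski.leray t,
    ⟨_, PAdicMinkowski.isGelfandLerayForm_eulerForm ht,
      PAdicMinkowski.isMeasureOfForm_leray hp ht⟩,
    fun _ h => h.eq_leray hp ht,
    hinv,
    fun _ hφ => ⟨PAdicMinkowski.integrable_of_isTestFunction hinv hφ,
      fun _ hΛ => PAdicMinkowski.integral_act_eq hinv hφ hΛ⟩,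
    fun _ hμ => hμ.exists_eq_smul ht hinv⟩
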